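/- Let $\varphi(s)=\frac{2s}{(s-1)(s+2)}$, and let $p_s(n)=\frac{\log n}{n}$ if $s=2$ and $p_s(n)=n^{-\varphi(s)}$ if $s\ge 3$. For every integer $s\ge 2$ there are constants $\beta,C>0$ such that the following holds. Let $G$ be an $n$-vertex graph with minimum degree $g\le\beta n$, and let $G_{n,p}$ be the binomial random graph on the vertex set of $G$ with edge probability $p=\min\{1,\,C\,p_s(n)\}$. Then, with probability tending to $1$ as $n\to\infty$, uniformly over all such graphs $G$, the graph $G\cup G_{n,p}$ contains a collection of $g$ pairwise vertex-disjoint copies of the complete graph $K_{s+1}$. (That is, for every $\varepsilon>0$ there is an $N$, depending only on $s,\beta,C,\varepsilon$, such that for all $n\ge N$ and all such $G$ the probability is at least $1-\varepsilon$.) -/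

import Mathlib

/-- The exponent `φ(s) = 2s / ((s - 1)(s + 2))`, used for `s ≥ 3`. -/
noncomputable def phiExp (s : ℕ) : ℝ :=
  2 * (s : ℝ) / (((s : ℝ) - 1) * ((s : ℝ) + 2))

/-- The function `p_s(n)`: `log n / n` if `s = 2`, and `n ^ (-φ(s))` if `s ≥ 3`. -/
noncomputable def thresholdProb (s n : ℕ) : ℝ :=
  if s = 2 then Real.log (n : ℝ) / (n : ℝ) else (n : ℝ) ^ (-phiExp s)

/-- A real number truncated to `[0, 1]`, as an edge probability; for `0 ≤ x` this is `min 1 x`. -/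
noncomputable def truncProb (x : ℝ) : unitInterval :=
  Set.projIcc (0 : ℝ) 1 zero_le_one x

/-- `H` contains a collection of `g` pairwise vertex-disjoint copies of the complete graph `K_k`. -/
def HasDisjointCliques {V : Type*} (H : SimpleGraph V) (k g : ℕ) : Prop :=
  ∃ K : Fin g → Finset V,
    (∀ i, H.IsNClique k (K i)) ∧ ∀ i j, i ≠ j → Disjoint (K i) (K j)

set_option linter.unusedSectionVars false
set_option linter.unusedDecidableInType false
set_option linter.unusedFintypeInType false

/-! Put M = C(s+1,2) - 1, so that φ(s) M = s. A fixed edge of G is expected to extend to about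
n^(s-1) p^M copies of K_{s+1} whose other edges are random, and n · n^(s-1) p^M equals C^M for s ≥ 3
and C² log² n for s = 2. A graph of minimum degree g has at least gn/2 edges, so for large C the
expected number of such copies is a large multiple of g. The work is to make g of them disjoint.

Choose b = o(n) such that with high probability every b vertices contain a random K_s (`janson` and
a union bound over at most 2^n sets). Then a vertex with b free neighbours in G completes a K_{s+1},
and large degrees are handled deterministically (`packing_reduction`): vertices of linear degree,
and later those of degree well above b, are served greedily one by one. If the minimum degree left
after removing the former is at least 4b, a double count shows that the greedy choice never gets
stuck. What can remain is a set Z of at least n/2 vertices in which G has all degrees between some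
g' ≤ 4b and O(b), and from which g' cliques are wanted.

For Z one uses second moments and deletion (`pr_not_packing_le`, `deletion`). If g' is at most a
quarter of the expected number of purely random cliques in fixed parts, those suffice. Otherwise a
bipartite subgraph of G[Z] is thinned by a factor ρ, so that its degrees are O(b/ρ), then trimmed to
about n g'/(48ρ) edges, which are completed by random ones. Among partial overlaps a single shared
vertex costs most (`pow_mul_pow_le`), and the relative cost is of order b/n + ρp, which tends to 0.
For s ≥ 3 one takes ρ = 1; for s = 2, ρ is about log² n. -/

section

open Finset

namespace RandomSubset

/-! ### Expectations over a random subset with independent coordinates -/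

section Indicator

variable {α : Type*}

open Classical in
/-- Indicator of a property of finite sets. -/
noncomputable def ind (P : Finset α → Prop) (S : Finset α) : ℝ := if P S then 1 else 0

lemma ind_of_pos {P : Finset α → Prop} {S} (h : P S) : ind P S = 1 := if_pos h

lemma ind_of_neg {P : Finset α → Prop} {S} (h : ¬ P S) : ind P S = 0 := if_neg h

lemma ind_nonneg (P : Finset α → Prop) (S) : 0 ≤ ind P S := by unfold ind; split_ifs <;> simp

lemma ind_le_one (P : Finset α → Prop) (S) : ind P S ≤ 1 := by unfold ind; split_ifs <;> simp

end Indicator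

variable {α : Type*} [Fintype α] [DecidableEq α]

/-- The probability that the random subset, containing each `e` independently with probability
`π e`, equals `S`. -/
noncomputable def weight (π : α → ℝ) (S : Finset α) : ℝ :=
  ∏ e, if e ∈ S then π e else 1 - π e

/-- Expectation over the random subset. -/
noncomputable def expect (π : α → ℝ) (f : Finset α → ℝ) : ℝ := ∑ S, weight π S * f S

/-- Probability that the random subset has a property. -/
noncomputable def pr (π : α → ℝ) (P : Finset α → Prop) : ℝ := expect π (ind P)

lemma sum_weight (π : α → ℝ) : ∑ S, weight π S = 1 := by
  have h := Fintype.prod_add π (fun e => 1 - π e)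
  simp only [add_sub_cancel, prod_const_one] at h
  rw [h]
  refine sum_congr rfl fun S _ => ?_
  rw [weight, prod_ite, filter_mem_eq_inter, univ_inter]
  congr 1
  refine prod_congr ?_ fun _ _ => rfl
  ext; simp

lemma weight_nonneg {π : α → ℝ} (h0 : ∀ e, 0 ≤ π e) (h1 : ∀ e, π e ≤ 1) (S : Finset α) :
    0 ≤ weight π S := by
  refine prod_nonneg fun e _ => ?_
  split_ifs
  · exact h0 e
  · linarith [h1 e]

lemma expect_mono {π : α → ℝ} (h0 : ∀ e, 0 ≤ π e) (h1 : ∀ e, π e ≤ 1) {f g : Finset α → ℝ}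
    (h : ∀ S, f S ≤ g S) : expect π f ≤ expect π g :=
  sum_le_sum fun S _ => mul_le_mul_of_nonneg_left (h S) (weight_nonneg h0 h1 S)

lemma expect_add (π : α → ℝ) (f g : Finset α → ℝ) :
    expect π (fun S => f S + g S) = expect π f + expect π g := by
  simp [expect, mul_add, sum_add_distrib]

lemma expect_sub (π : α → ℝ) (f g : Finset α → ℝ) :
    expect π (fun S => f S - g S) = expect π f - expect π g := by
  simp [expect, mul_sub, sum_sub_distrib]

lemma expect_const_mul (π : α → ℝ) (c : ℝ) (f : Finset α → ℝ) :
    expect π (fun S => c * f S) = c * expect π f := by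
  simp only [expect, mul_sum]
  exact sum_congr rfl fun _ _ => by ring

lemma expect_const (π : α → ℝ) (c : ℝ) : expect π (fun _ => c) = c := by
  simp [expect, ← sum_mul, sum_weight]

lemma expect_sum {ι : Type*} (π : α → ℝ) (I : Finset ι) (f : ι → Finset α → ℝ) :
    expect π (fun S => ∑ i ∈ I, f i S) = ∑ i ∈ I, expect π (f i) := by
  simp only [expect, mul_sum]
  exact sum_comm

lemma expect_nonneg {π : α → ℝ} (h0 : ∀ e, 0 ≤ π e) (h1 : ∀ e, π e ≤ 1) {f : Finset α → ℝ}
    (h : ∀ S, 0 ≤ f S) : 0 ≤ expect π f :=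
  sum_nonneg fun S _ => mul_nonneg (weight_nonneg h0 h1 S) (h S)

lemma pr_nonneg {π : α → ℝ} (h0 : ∀ e, 0 ≤ π e) (h1 : ∀ e, π e ≤ 1) (P : Finset α → Prop) :
    0 ≤ pr π P := expect_nonneg h0 h1 (ind_nonneg P)

lemma pr_mono {π : α → ℝ} (h0 : ∀ e, 0 ≤ π e) (h1 : ∀ e, π e ≤ 1) {P Q : Finset α → Prop}
    (h : ∀ S, P S → Q S) : pr π P ≤ pr π Q := by
  refine expect_mono h0 h1 fun S => ?_
  unfold ind
  have := h S
  split_ifs <;> simp_all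

lemma pr_or_le {π : α → ℝ} (h0 : ∀ e, 0 ≤ π e) (h1 : ∀ e, π e ≤ 1) (P Q : Finset α → Prop) :
    pr π (fun S => P S ∨ Q S) ≤ pr π P + pr π Q := by
  rw [pr, pr, pr, ← expect_add]
  refine expect_mono h0 h1 fun S => ?_
  unfold ind
  by_cases hP : P S <;> by_cases hQ : Q S <;> simp [hP, hQ]

lemma pr_exists_le {π : α → ℝ} (h0 : ∀ e, 0 ≤ π e) (h1 : ∀ e, π e ≤ 1) {ι : Type*} (I : Finset ι)
    (P : ι → Finset α → Prop) : pr π (fun S => ∃ i ∈ I, P i S) ≤ ∑ i ∈ I, pr π (P i) := by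
  simp only [pr]
  rw [← expect_sum]
  refine expect_mono h0 h1 fun S => ?_
  by_cases h : ∃ i ∈ I, P i S
  · obtain ⟨i, hi, hP⟩ := h
    refine (ind_le_one _ _).trans ?_
    have : ind (P i) S = 1 := by simp [ind, hP]
    rw [← this]
    exact single_le_sum (f := fun i => ind (P i) S) (fun j _ => ind_nonneg _ _) hi
  · have : ind (fun S => ∃ i ∈ I, P i S) S = 0 := by simp only [ind, if_neg h]
    rw [this]
    exact sum_nonneg fun j _ => ind_nonneg _ _

lemma pr_not (π : α → ℝ) (P : Finset α → Prop) : pr π (fun S => ¬ P S) = 1 - pr π P := by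
  have h : ∀ S, ind (fun S => ¬ P S) S = 1 - ind P S := by
    intro S; unfold ind; by_cases hP : P S <;> simp [hP]
  rw [pr, funext h, expect_sub, expect_const, pr]

lemma pr_ge_le {π : α → ℝ} (h0 : ∀ e, 0 ≤ π e) (h1 : ∀ e, π e ≤ 1) {f : Finset α → ℝ}
    (hf : ∀ S, 0 ≤ f S) {t : ℝ} (ht : 0 < t) : pr π (fun S => t ≤ f S) ≤ expect π f / t := by
  rw [le_div_iff₀ ht, mul_comm, pr, ← expect_const_mul]
  refine expect_mono h0 h1 fun S => ?_
  unfold ind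
  split_ifs with h
  · simpa using h
  · simpa using hf S

/-- Conditioning on all coordinates but `e`: a set avoiding `e` is paired with the set obtained by
adding `e`. -/
lemma sum_eq_sum_insert (e : α) (g : Finset α → ℝ) :
    ∑ S, g S = ∑ S ∈ univ.filter (fun S : Finset α => e ∉ S), (g S + g (insert e S)) := by
  rw [← sum_filter_add_sum_filter_not univ (fun S : Finset α => e ∉ S), sum_add_distrib]
  congr 1
  refine sum_nbij' (fun S => S.erase e) (fun S => insert e S) ?_ ?_ ?_ ?_ ?_ <;>
    simp +contextual [insert_erase]

/-- Cross-multiplied so as to cover π e = 1 as well. -/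
lemma weight_insert (π : α → ℝ) {e : α} {S : Finset α} (he : e ∉ S) :
    weight π (insert e S) * (1 - π e) = weight π S * π e := by
  unfold weight
  rw [← mul_prod_erase univ _ (mem_univ e), ← mul_prod_erase univ _ (mem_univ e)]
  have : ∏ x ∈ univ.erase e, (if x ∈ insert e S then π x else 1 - π x) =
      ∏ x ∈ univ.erase e, (if x ∈ S then π x else 1 - π x) := by
    refine prod_congr rfl fun x hx => ?_
    simp [(mem_erase.1 hx).1]
  rw [this]
  simp [he]
  ring

lemma weight_add_insert (π : α → ℝ) {e : α} {S : Finset α} (he : e ∉ S) :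
    weight π (insert e S) = π e * (weight π S + weight π (insert e S)) := by
  linarith [weight_insert π he]

/-- A coordinate on which `f` does not depend is independent of `f`. -/
lemma expect_mul_ind_mem (π : α → ℝ) {e : α} {f : Finset α → ℝ}
    (hf : ∀ S, e ∉ S → f (insert e S) = f S) :
    expect π (fun S => f S * ind (fun S => e ∈ S) S) = π e * expect π f := by
  unfold expect
  rw [sum_eq_sum_insert e, sum_eq_sum_insert e, mul_sum]
  refine sum_congr rfl fun S hS => ?_
  have he : e ∉ S := (mem_filter.1 hS).2
  simp only [ind, he, hf S he, mem_insert_self, if_true, if_false]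
  linear_combination f S * weight_add_insert π he

lemma expect_mul_ind_subset (π : α → ℝ) (F : Finset α) {f : Finset α → ℝ}
    (hf : ∀ e ∈ F, ∀ S, e ∉ S → f (insert e S) = f S) :
    expect π (fun S => f S * ind (fun S => F ⊆ S) S) = (∏ e ∈ F, π e) * expect π f := by
  induction F using Finset.induction_on with
  | empty => simp [ind]
  | insert a F ha ih =>
    rw [prod_insert ha, mul_assoc, ← ih fun e he => hf e (mem_insert_of_mem he),
      ← expect_mul_ind_mem]
    · congr 1
      ext S
      simp only [ind, insert_subset_iff]
      by_cases h1 : a ∈ S <;> by_cases h2 : F ⊆ S <;> simp [h1, h2]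
    · intro S hS
      rw [hf a (mem_insert_self _ _) S hS]
      by_cases h : F ⊆ S
      · rw [ind_of_pos h, ind_of_pos ((subset_insert_iff_of_notMem ha).2 h)]
      · rw [ind_of_neg h, ind_of_neg (mt (subset_insert_iff_of_notMem ha).1 h)]

lemma pr_subset (π : α → ℝ) (F : Finset α) : pr π (fun S => F ⊆ S) = ∏ e ∈ F, π e := by
  have := expect_mul_ind_subset π F (f := fun _ => 1) (by simp)
  simpa [expect_const, pr] using this

/-! ### The Harris and Janson inequalities -/

lemma weight_mul_weight (π : α → ℝ) (S T : Finset α) :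
    weight π S * weight π T = weight π (S ⊓ T) * weight π (S ⊔ T) := by
  unfold weight
  rw [← prod_mul_distrib, ← prod_mul_distrib]
  refine prod_congr rfl fun e _ => ?_
  by_cases h1 : e ∈ S <;> by_cases h2 : e ∈ T <;> (simp [h1, h2]; try ring)

lemma harris {π : α → ℝ} (h0 : ∀ e, 0 ≤ π e) (h1 : ∀ e, π e ≤ 1) {f g : Finset α → ℝ}
    (hf0 : ∀ S, 0 ≤ f S) (hg0 : ∀ S, 0 ≤ g S) (hf : Monotone f) (hg : Monotone g) :
    expect π f * expect π g ≤ expect π (fun S => f S * g S) := by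
  have := fkg f g (weight π) (weight_nonneg h0 h1) hf0 hg0 hf hg
    (fun S T => (weight_mul_weight π S T).le)
  rwa [sum_weight, one_mul] at this

variable {ι : Type*}

/-- Increasing and decreasing events are negatively correlated: Harris is applied to the first event
and the complement of the second. -/
lemma pr_subset_and_none_le {π : α → ℝ} (h0 : ∀ e, 0 ≤ π e) (h1 : ∀ e, π e ≤ 1) (A : Finset α)
    (I : Finset ι) (F : ι → Finset α) :
    pr π (fun S => A ⊆ S ∧ ∀ i ∈ I, ¬ F i ⊆ S) ≤
      pr π (fun S => A ⊆ S) * pr π (fun S => ∀ i ∈ I, ¬ F i ⊆ S) := by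
  have hA : Monotone (ind fun S : Finset α => A ⊆ S) := by
    intro S T hST
    unfold ind
    split_ifs with a b
    · exact le_rfl
    · exact absurd (a.trans hST) b
    · simp
    · exact le_rfl
  have hE : Monotone (ind fun S : Finset α => ∃ i ∈ I, F i ⊆ S) := by
    intro S T hST
    unfold ind
    split_ifs with a b
    · exact le_rfl
    · obtain ⟨i, hi, h⟩ := a
      exact absurd ⟨i, hi, h.trans hST⟩ b
    · simp
    · exact le_rfl
  have key := harris h0 h1 (ind_nonneg _) (ind_nonneg _) hA hE
  have e1 : pr π (fun S => ∀ i ∈ I, ¬ F i ⊆ S) = 1 - pr π (fun S => ∃ i ∈ I, F i ⊆ S) := by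
    rw [← pr_not]; simp
  have e2 : pr π (fun S => A ⊆ S ∧ ∀ i ∈ I, ¬ F i ⊆ S) = pr π (fun S => A ⊆ S) -
      expect π (fun S => ind (fun S => A ⊆ S) S * ind (fun S => ∃ i ∈ I, F i ⊆ S) S) := by
    rw [pr, pr, ← expect_sub]
    congr 1
    ext S
    unfold ind
    by_cases a : A ⊆ S <;> by_cases b : ∃ i ∈ I, F i ⊆ S
    · simp only [a, b, if_true]
      rw [if_neg]; · norm_num
      rintro ⟨-, h⟩
      obtain ⟨i, hi, hb⟩ := b
      exact h i hi hb
    · simp only [a, b, if_true, if_false]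
      rw [if_pos]; · norm_num
      push Not at b
      exact ⟨trivial, b⟩
    · simp [a]
    · simp [a]
  rw [e1, e2]
  simp only [pr] at *
  linarith

/-- Janson's inequality. -/
lemma janson [DecidableEq ι] {π : α → ℝ} (h0 : ∀ e, 0 ≤ π e) (h1 : ∀ e, π e ≤ 1) (I : Finset ι)
    (F : ι → Finset α) :
    pr π (fun S => ∀ i ∈ I, ¬ F i ⊆ S) ≤ Real.exp (-∑ i ∈ I, ∏ e ∈ F i, π e +
      ∑ i ∈ I, ∑ j ∈ I with j ≠ i ∧ ¬ Disjoint (F i) (F j), ∏ e ∈ F i ∪ F j, π e) := by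
  induction I using Finset.induction_on with
  | empty =>
    have : ind (fun _ : Finset α => True) = fun _ => 1 := funext fun S => ind_of_pos trivial
    simp [pr, this, expect_const]
  | insert a I ha ih =>
    set N := pr π (fun S => ∀ i ∈ I, ¬ F i ⊆ S)
    -- `I1` indexes the events that share a coordinate with that of `a`, `I2` those independent of
    -- it.
    set I1 := I.filter fun j => ¬ Disjoint (F a) (F j)
    set I2 := I.filter fun j => Disjoint (F a) (F j)
    set N2 := pr π (fun S => ∀ i ∈ I2, ¬ F i ⊆ S)
    set Pa := ∏ e ∈ F a, π e
    set Da := ∑ j ∈ I1, ∏ e ∈ F a ∪ F j, π e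
    have hN0 : 0 ≤ N := pr_nonneg h0 h1 _
    have hNN : N ≤ N2 := pr_mono h0 h1 fun S h i hi => h i (mem_of_mem_filter _ hi)
    -- P(F_a, none of I) is at least P(F_a, none of I2) minus the sum over j in I1 of P(F_a, F_j,
    -- none of I2). Independence evaluates the first term and Harris bounds the others; if Pa < Da
    -- there is nothing to prove.
    have hstep : N * (Pa - Da) ≤ pr π (fun S => F a ⊆ S ∧ ∀ i ∈ I, ¬ F i ⊆ S) := by
      rcases le_total 0 (Pa - Da) with hpos | hneg
      · refine (mul_le_mul_of_nonneg_right hNN hpos).trans ?_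
        have hind : pr π (fun S => F a ⊆ S ∧ ∀ i ∈ I2, ¬ F i ⊆ S) = Pa * N2 := by
          have e := expect_mul_ind_subset π (F a) (f := ind fun S => ∀ i ∈ I2, ¬ F i ⊆ S) ?_
          · refine Eq.trans ?_ e
            unfold pr
            congr 1; ext S; unfold ind
            by_cases x : F a ⊆ S <;> simp [x]
          · intro e he S _
            unfold ind
            congr 1
            refine propext (forall₂_congr fun i hi => not_congr ?_)
            exact subset_insert_iff_of_notMem
              (disjoint_left.1 (mem_filter.1 hi).2 he)
        have hsum : ∑ j ∈ I1, pr π (fun S => F a ∪ F j ⊆ S ∧ ∀ i ∈ I2, ¬ F i ⊆ S) ≤ Da * N2 := by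
          rw [sum_mul]
          refine sum_le_sum fun j _ => ?_
          rw [← pr_subset]
          exact pr_subset_and_none_le h0 h1 _ _ _
        have hunion : pr π (fun S => F a ⊆ S ∧ ∀ i ∈ I2, ¬ F i ⊆ S) ≤
            pr π (fun S => F a ⊆ S ∧ ∀ i ∈ I, ¬ F i ⊆ S) +
            ∑ j ∈ I1, pr π (fun S => F a ∪ F j ⊆ S ∧ ∀ i ∈ I2, ¬ F i ⊆ S) := by
          refine le_trans ?_ (add_le_add le_rfl (pr_exists_le h0 h1 _ _))
          refine le_trans (pr_mono h0 h1 ?_) (pr_or_le h0 h1 _ _)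
          rintro S ⟨hA, hB⟩
          by_cases h : ∀ i ∈ I, ¬ F i ⊆ S
          · exact Or.inl ⟨hA, h⟩
          · push Not at h
            obtain ⟨j, hj, hjS⟩ := h
            refine Or.inr ⟨j, ?_, union_subset hA hjS, hB⟩
            refine mem_filter.2 ⟨hj, fun hd => hB j (mem_filter.2 ⟨hj, hd⟩) hjS⟩
        linarith
      · exact (mul_nonpos_of_nonneg_of_nonpos hN0 hneg).trans (pr_nonneg h0 h1 _)
    have hsplit : pr π (fun S => ∀ i ∈ insert a I, ¬ F i ⊆ S) =
        N - pr π (fun S => F a ⊆ S ∧ ∀ i ∈ I, ¬ F i ⊆ S) := by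
      simp only [N, pr]
      rw [← expect_sub]
      congr 1; ext S
      simp only [forall_mem_insert]
      by_cases y : ∀ i ∈ I, ¬ F i ⊆ S
      · rw [ind_of_pos (P := fun S => ∀ i ∈ I, ¬ F i ⊆ S) y]
        by_cases x : F a ⊆ S
        · rw [ind_of_neg (fun h => h.1 x), ind_of_pos ⟨x, y⟩, sub_self]
        · rw [ind_of_pos ⟨x, y⟩, ind_of_neg (fun h => x h.1), sub_zero]
      · rw [ind_of_neg (fun h => y h.2), ind_of_neg (fun h => y h), ind_of_neg (fun h => y h.2),
          sub_zero]
    have hle : pr π (fun S => ∀ i ∈ insert a I, ¬ F i ⊆ S) ≤ N * Real.exp (-Pa + Da) := by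
      rw [hsplit]
      have := mul_le_mul_of_nonneg_left (Real.add_one_le_exp (-Pa + Da)) hN0
      linarith
    refine hle.trans ((mul_le_mul_of_nonneg_right ih (Real.exp_pos _).le).trans ?_)
    rw [← Real.exp_add]
    refine Real.exp_le_exp.2 ?_
    rw [sum_insert ha, sum_insert ha]
    have hπ : ∀ A : Finset α, 0 ≤ ∏ e ∈ A, π e := fun A => prod_nonneg fun e _ => h0 e
    -- The double sum runs over ordered pairs while only the pairs (a, j) are needed, so a factor 2
    -- is given away in the correlation term.
    have k1 : Da ≤ ∑ j ∈ insert a I with j ≠ a ∧ ¬ Disjoint (F a) (F j),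
        ∏ e ∈ F a ∪ F j, π e := by
      refine sum_le_sum_of_subset_of_nonneg (fun j hj => ?_) fun _ _ _ => hπ _
      obtain ⟨hj, hd⟩ := mem_filter.1 hj
      exact mem_filter.2 ⟨mem_insert_of_mem hj, fun h => ha (h ▸ hj), hd⟩
    have k2 : ∑ i ∈ I, ∑ j ∈ I with j ≠ i ∧ ¬ Disjoint (F i) (F j), ∏ e ∈ F i ∪ F j, π e ≤
        ∑ i ∈ I, ∑ j ∈ insert a I with j ≠ i ∧ ¬ Disjoint (F i) (F j),
          ∏ e ∈ F i ∪ F j, π e :=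
      sum_le_sum fun i _ => sum_le_sum_of_subset_of_nonneg
        (filter_subset_filter _ (subset_insert _ _)) fun _ _ _ => hπ _
    linarith

/-! ### Second moments and deletion -/

/-- The deletion method: many events of which few pairs conflict contain many that pairwise
do not. -/
lemma deletion [DecidableEq ι] {π : α → ℝ} (h0 : ∀ e, 0 ≤ π e) (h1 : ∀ e, π e ≤ 1) (I : Finset ι)
    (F : ι → Finset α) (R : ι → ι → Prop) [DecidableRel R]
    (hR : ∀ i ∈ I, ∀ j ∈ I, i ≠ j → ¬ R i j → Disjoint (F i) (F j)) {μ Λ : ℝ} (hμ : 0 < μ)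
    (hμe : ∑ i ∈ I, ∏ e ∈ F i, π e = μ)
    (hΛ : ∑ i ∈ I, ∑ j ∈ I with j ≠ i ∧ R i j, ∏ e ∈ F i ∪ F j, π e ≤ Λ)
    {g : ℕ} (hg : (g : ℝ) ≤ μ / 4) :
    pr π (fun S => ¬ ∃ J ⊆ I, J.card = g ∧ (∀ i ∈ J, F i ⊆ S) ∧
      ∀ i ∈ J, ∀ j ∈ J, i ≠ j → ¬ R i j) ≤ 4 * (μ + Λ) / μ ^ 2 + 4 * Λ / μ := by
  classical
  -- X counts the events that occur, Y the ordered conflicting pairs among them. Chebyshev keeps X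
  -- above μ/2, Markov keeps Y below μ/4.
  set X : Finset α → ℝ := fun S => ∑ i ∈ I, ind (fun S => F i ⊆ S) S
  set Y : Finset α → ℝ := fun S => ∑ i ∈ I, ∑ j ∈ I with j ≠ i ∧ R i j,
    ind (fun S => F i ∪ F j ⊆ S) S
  have hEX : expect π X = μ := by
    rw [expect_sum, ← hμe]
    exact sum_congr rfl fun i _ => pr_subset π _
  have hEY : expect π Y ≤ Λ := by
    rw [expect_sum]
    simp_rw [expect_sum]
    refine le_trans (le_of_eq ?_) hΛ
    exact sum_congr rfl fun i _ => sum_congr rfl fun j _ => pr_subset π _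
  have hπ : ∀ A : Finset α, 0 ≤ ∏ e ∈ A, π e := fun A => prod_nonneg fun e _ => h0 e
  have hEX2 : expect π (fun S => X S * X S) ≤ μ ^ 2 + μ + Λ := by
    have e1 : (fun S => X S * X S) =
        fun S => ∑ i ∈ I, ∑ j ∈ I, ind (fun S => F i ∪ F j ⊆ S) S := by
      ext S
      simp only [X, sum_mul_sum]
      refine sum_congr rfl fun i _ => sum_congr rfl fun j _ => ?_
      simp only [ind, union_subset_iff]
      by_cases x : F i ⊆ S <;> by_cases y : F j ⊆ S <;> simp [x, y]
    rw [e1, expect_sum]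
    simp_rw [expect_sum]
    -- Events not in conflict use disjoint coordinates, so the joint probability factors.
    have e2 : ∀ i ∈ I, ∀ j ∈ I, expect π (ind fun S => F i ∪ F j ⊆ S) ≤
        (∏ e ∈ F i, π e) * (∏ e ∈ F j, π e) + (if j = i then ∏ e ∈ F i, π e else 0) +
        (if j ≠ i ∧ R i j then ∏ e ∈ F i ∪ F j, π e else 0) := by
      intro i hi j hj
      rw [show expect π (ind fun S => F i ∪ F j ⊆ S) = ∏ e ∈ F i ∪ F j, π e from pr_subset π _]
      have := mul_nonneg (hπ (F i)) (hπ (F j))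
      by_cases hij : j = i
      · subst hij
        simp only [union_self, if_true, ne_eq, not_true, false_and, if_false]
        linarith
      · by_cases hr : R i j
        · simp only [hij, hr, if_false, ne_eq, not_false_eq_true, and_self, if_true]
          linarith
        · rw [prod_union (hR i hi j hj (Ne.symm hij) hr)]
          simp [hij, hr]
    refine (sum_le_sum fun i hi => sum_le_sum fun j hj => e2 i hi j hj).trans ?_
    simp only [sum_add_distrib, ← sum_mul_sum, hμe, ← sum_filter]
    have : ∑ i ∈ I, ∑ j ∈ I with j = i, ∏ e ∈ F i, π e = μ := by
      rw [← hμe]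
      refine sum_congr rfl fun i hi => ?_
      rw [filter_eq' I i, if_pos hi, sum_singleton]
    linarith
  have hvar : expect π (fun S => (X S - μ) ^ 2) ≤ μ + Λ := by
    have e1 : (fun S => (X S - μ) ^ 2) = fun S => X S * X S - (2 * μ * X S - μ ^ 2) := by
      ext S; ring
    rw [e1, expect_sub, expect_sub, expect_const_mul, expect_const, hEX]
    linarith
  have hY0 : ∀ S, 0 ≤ Y S := fun S =>
    sum_nonneg fun i _ => sum_nonneg fun j _ => ind_nonneg _ _
  have b1 := pr_ge_le h0 h1 (f := fun S => (X S - μ) ^ 2) (fun S => sq_nonneg _)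
    (t := (μ / 2) ^ 2) (by positivity)
  have b2 := pr_ge_le h0 h1 hY0 (t := μ / 4) (by positivity)
  have b3 : pr π (fun S => (μ / 2) ^ 2 ≤ (X S - μ) ^ 2) ≤ 4 * (μ + Λ) / μ ^ 2 := by
    refine b1.trans ?_
    rw [show 4 * (μ + Λ) / μ ^ 2 = (μ + Λ) / (μ / 2) ^ 2 by field_simp; ring]
    exact div_le_div_of_nonneg_right hvar (by positivity)
  have b4 : pr π (fun S => μ / 4 ≤ Y S) ≤ 4 * Λ / μ := by
    refine b2.trans ?_
    rw [div_div_eq_mul_div, mul_comm]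
    gcongr
  refine le_trans ?_ (add_le_add b3 b4)
  refine le_trans (pr_mono h0 h1 ?_) (pr_or_le h0 h1 _ _)
  intro S hS
  by_contra hcon
  push Not at hcon
  obtain ⟨hx, hy⟩ := hcon
  apply hS
  have hX : μ / 2 < X S := by nlinarith
  -- Of the more than μ/2 events in J0, fewer than μ/4 are in conflict with another (J1); the rest
  -- form J2.
  set J0 := I.filter fun i => F i ⊆ S
  set J1 := J0.filter fun i => ∃ j ∈ J0, j ≠ i ∧ R i j
  set J2 := J0.filter fun i => ¬ ∃ j ∈ J0, j ≠ i ∧ R i j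
  have c0 : X S = J0.card := by
    simp only [X, ind, J0, card_filter]
    push_cast
    exact sum_congr rfl fun i _ => by congr
  have c1 : (J1.card : ℝ) ≤ Y S := by
    have : (J1.card : ℝ) = ∑ i ∈ I, if i ∈ J1 then (1 : ℝ) else 0 := by
      rw [← sum_filter, filter_mem_eq_inter, inter_eq_right.2]
      · simp
      · exact (filter_subset _ _).trans (filter_subset _ _)
    rw [this]
    refine sum_le_sum fun i hi => ?_
    split_ifs with h
    · obtain ⟨h1, j, hj, hji, hr⟩ := mem_filter.1 h
      have h2 : ind (fun S => F i ∪ F j ⊆ S) S = 1 := by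
        simp only [ind]
        rw [if_pos]
        exact union_subset (mem_filter.1 h1).2 (mem_filter.1 hj).2
      rw [← h2]
      exact single_le_sum (f := fun j => ind (fun S => F i ∪ F j ⊆ S) S)
        (fun j _ => ind_nonneg _ _) (mem_filter.2 ⟨(mem_filter.1 hj).1, hji, hr⟩)
    · exact sum_nonneg fun j _ => ind_nonneg _ _
  have c2 : J1.card + J2.card = J0.card := card_filter_add_card_filter_not _
  have c3 : g ≤ J2.card := by
    have : (J1.card : ℝ) + J2.card = J0.card := by exact_mod_cast c2
    have : (g : ℝ) < J2.card := by linarith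
    exact_mod_cast this.le
  obtain ⟨J, hJ, hJc⟩ := exists_subset_card_eq c3
  refine ⟨J, hJ.trans ((filter_subset _ _).trans (filter_subset _ _)), hJc, ?_, ?_⟩
  · intro i hi
    exact (mem_filter.1 (mem_filter.1 (hJ hi)).1).2
  · intro i hi j hj hij hr
    exact (mem_filter.1 (hJ hi)).2 ⟨j, (mem_filter.1 (hJ hj)).1, hij.symm, hr⟩

/-! ### The binomial random graph as a random set of pairs -/

section RandomGraph

variable {V : Type*} [Fintype V] [DecidableEq V]

/-- Marginals of the edge set of the binomial random graph. -/
noncomputable def edgeProb (V : Type*) [DecidableEq V] (p : ℝ) (e : Sym2 V) : ℝ :=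
  if e.IsDiag then 0 else p

lemma edgeProb_nonneg {p : ℝ} (hp : 0 ≤ p) (e : Sym2 V) : 0 ≤ edgeProb V p e := by
  unfold edgeProb; split_ifs <;> simp [hp]

lemma edgeProb_le_one {p : ℝ} (hp : p ≤ 1) (e : Sym2 V) : edgeProb V p e ≤ 1 := by
  unfold edgeProb; split_ifs <;> simp [hp]

lemma prod_edgeProb {p : ℝ} {F : Finset (Sym2 V)} (hF : ∀ e ∈ F, ¬ e.IsDiag) :
    ∏ e ∈ F, edgeProb V p e = p ^ F.card := by
  rw [← prod_const]
  exact prod_congr rfl fun e he => if_neg (hF e he)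

/-- Loops have marginal 0 in `edgeProb`, so a set containing one has weight 0, in agreement with a
measure carried by the non-diagonal pairs. -/
lemma setBernoulli_real_singleton_eq_weight (p : unitInterval) (S : Finset (Sym2 V)) :
    (ProbabilityTheory.setBernoulli (Sym2.diagSetᶜ : Set (Sym2 V)) p).real {(S : Set (Sym2 V))} =
      weight (edgeProb V p) S := by
  classical
  by_cases h : (S : Set (Sym2 V)) ⊆ Sym2.diagSetᶜ
  · rw [ProbabilityTheory.setBernoulli_real_singleton p h (Set.toFinite _)]
    have hS : ∀ e ∈ S, ¬ e.IsDiag := fun e he => by simpa using h he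
    set D : Finset (Sym2 V) := univ.filter fun e => ¬ e.IsDiag
    have hSD : S ⊆ D := fun e he => by simp [D, hS e he]
    have h1 : ((Sym2.diagSetᶜ : Set (Sym2 V)) \ S).ncard = (D \ S).card := by
      rw [← Set.ncard_coe_finset]
      congr 1
      ext e; simp [D]
    rw [h1, Set.ncard_coe_finset, weight, ← prod_subset (subset_univ D), ← prod_sdiff hSD,
      mul_comm, ← prod_const, ← prod_const]
    · congr 1
      · refine prod_congr rfl fun e he => ?_
        rw [if_neg (mem_sdiff.1 he).2, edgeProb,
          if_neg (mem_filter.1 (mem_sdiff.1 he).1).2]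
      · refine prod_congr rfl fun e he => ?_
        rw [if_pos he, edgeProb, if_neg (hS e he)]
    · intro e _ he
      have hd : e.IsDiag := by simpa [D] using he
      rw [if_neg fun h => hS e h hd, edgeProb, if_pos hd, sub_zero]
  · rw [MeasureTheory.measureReal_def,
      ProbabilityTheory.setBernoulli_singleton_of_not_subset p h]
    obtain ⟨e, he, hd⟩ := Set.not_subset.1 h
    have hd : e.IsDiag := by simpa using hd
    symm
    refine prod_eq_zero (mem_univ e) ?_
    rw [if_pos (by simpa using he), edgeProb, if_pos hd]

lemma binomialRandom_real_eq_pr (p : unitInterval) (A : Set (SimpleGraph V)) :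
    (SimpleGraph.binomialRandom V p).real A =
      pr (edgeProb V p) fun S => SimpleGraph.fromEdgeSet (S : Set (Sym2 V)) ∈ A := by
  classical
  have hA : MeasurableSet A := by
    rw [← Set.preimage_image_eq A SimpleGraph.edgeSet_injective]
    exact SimpleGraph.measurable_edgeSet .of_discrete
  rw [SimpleGraph.binomialRandom_eq_map, MeasureTheory.measureReal_def,
    MeasureTheory.Measure.map_apply SimpleGraph.measurable_fromEdgeSet hA,
    ← MeasureTheory.measureReal_def]
  set B : Finset (Finset (Sym2 V)) :=
    univ.filter fun S => SimpleGraph.fromEdgeSet (S : Set (Sym2 V)) ∈ A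
  have hB : SimpleGraph.fromEdgeSet ⁻¹' A = ⋃ S ∈ B, {(S : Set (Sym2 V))} := by
    ext T
    simp only [Set.mem_preimage, Set.mem_iUnion, Set.mem_singleton_iff, B, mem_filter, mem_univ,
      true_and, exists_prop]
    constructor
    · intro h
      exact ⟨T.toFinset, by simpa using h, by simp⟩
    · rintro ⟨S, hS, rfl⟩
      exact hS
  rw [hB, MeasureTheory.measureReal_biUnion_finset]
  · simp_rw [setBernoulli_real_singleton_eq_weight]
    rw [pr, expect, sum_filter]
    refine sum_congr rfl fun S _ => ?_
    unfold ind
    split_ifs <;> simp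
  · intro S _ T _ hST
    simpa [Function.onFun] using hST
  · intro S _
    exact .of_discrete

end RandomGraph

/-! ### Transversal tuples and their overlaps -/

section Tuples

variable {V κ : Type*} [DecidableEq V] [Fintype κ] [DecidableEq κ]

/-- The pairs of distinct elements of `A`. -/
def pairs (A : Finset κ) : Finset (Sym2 κ) := A.offDiag.image (Function.uncurry Sym2.mk)

lemma mk_mem_pairs {A : Finset κ} {i j : κ} : s(i, j) ∈ pairs A ↔ i ∈ A ∧ j ∈ A ∧ i ≠ j := by
  simp only [pairs, mem_image, mem_offDiag, Prod.exists, Function.uncurry_apply_pair, Sym2.eq_iff]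
  grind

lemma card_pairs (A : Finset κ) : (pairs A).card = A.card.choose 2 := Sym2.card_image_offDiag A

/-- The edges of `Q`, transported along `x`. -/
def edgesOf (Q : Finset (Sym2 κ)) (x : κ → V) : Finset (Sym2 V) := Q.image (Sym2.map x)

/-- The indices at which two tuples agree. -/
def agree (x y : κ → V) : Finset κ := univ.filter fun i => x i = y i

lemma mem_agree {x y : κ → V} {i : κ} : i ∈ agree x y ↔ x i = y i := by simp [agree]

/-- The members of `Q` with both ends in `A`. -/
def restrict (Q : Finset (Sym2 κ)) (A : Finset κ) : Finset (Sym2 κ) :=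
  Q.filter fun e => e ∈ pairs A

variable {P : κ → Finset V}

/-- The parts are disjoint, so a vertex determines its index. Hence two tuples can only meet at a
common index. -/
lemma index_eq (hP : ∀ i j, i ≠ j → Disjoint (P i) (P j))
    {x y : κ → V} (hx : ∀ i, x i ∈ P i) (hy : ∀ i, y i ∈ P i) {i j : κ}
    (h : x i = y j) : i = j := by
  by_contra hij
  exact disjoint_left.1 (hP i j hij) (hx i) (h ▸ hy j)

lemma card_edgesOf (hP : ∀ i j, i ≠ j → Disjoint (P i) (P j))
    {x : κ → V} (hx : ∀ i, x i ∈ P i) (Q : Finset (Sym2 κ)) :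
    (edgesOf Q x).card = Q.card :=
  card_image_of_injective _ (Sym2.map.injective fun _ _ h => index_eq hP hx hx h)

lemma not_isDiag_of_mem_edgesOf (hP : ∀ i j, i ≠ j → Disjoint (P i) (P j))
    {x : κ → V} (hx : ∀ i, x i ∈ P i) {Q : Finset (Sym2 κ)}
    (hQ : ∀ e ∈ Q, ¬ e.IsDiag) : ∀ e ∈ edgesOf Q x, ¬ e.IsDiag := by
  intro e he
  obtain ⟨q, hq, rfl⟩ := mem_image.1 he
  have := hQ q hq
  induction q using Sym2.ind with
  | _ a b =>
    simp only [Sym2.map_mk, Sym2.mk_isDiag_iff] at this ⊢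
    exact fun h => this (index_eq hP hx hx h)

/-- The indices of the ends of a common edge are determined by those ends, and both tuples take the
same values there. -/
lemma edgesOf_inter (hP : ∀ i j, i ≠ j → Disjoint (P i) (P j))
    {x y : κ → V} (hx : ∀ i, x i ∈ P i) (hy : ∀ i, y i ∈ P i)
    {Q : Finset (Sym2 κ)} (hQ : ∀ e ∈ Q, ¬ e.IsDiag) :
    edgesOf Q x ∩ edgesOf Q y = edgesOf (restrict Q (agree x y)) x := by
  ext e
  simp only [mem_inter, edgesOf, mem_image, restrict, mem_filter]
  constructor
  · rintro ⟨⟨a, ha, rfl⟩, b, hb, hab⟩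
    refine ⟨a, ⟨ha, ?_⟩, rfl⟩
    have hd := hQ a ha
    induction a using Sym2.ind with
    | _ i j =>
    induction b using Sym2.ind with
    | _ k l =>
    simp only [Sym2.map_mk, Sym2.mk_isDiag_iff, Sym2.eq_iff] at hab hd
    rw [mk_mem_pairs, mem_agree, mem_agree]
    rcases hab with ⟨h1, h2⟩ | ⟨h1, h2⟩
    · have e1 := index_eq hP hy hx h1
      have e2 := index_eq hP hy hx h2
      subst e1 e2
      exact ⟨h1.symm, h2.symm, hd⟩
    · have e1 := index_eq hP hy hx h1
      have e2 := index_eq hP hy hx h2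
      subst e1 e2
      exact ⟨h2.symm, h1.symm, hd⟩
  · rintro ⟨a, ⟨ha, hA⟩, rfl⟩
    refine ⟨⟨a, ha, rfl⟩, a, ha, ?_⟩
    induction a using Sym2.ind with
    | _ i j =>
    rw [mk_mem_pairs, mem_agree, mem_agree] at hA
    simp [hA.1, hA.2.1]

lemma card_edgesOf_union (hP : ∀ i j, i ≠ j → Disjoint (P i) (P j))
    {x y : κ → V} (hx : ∀ i, x i ∈ P i) (hy : ∀ i, y i ∈ P i)
    {Q : Finset (Sym2 κ)} (hQ : ∀ e ∈ Q, ¬ e.IsDiag) :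
    (edgesOf Q x ∪ edgesOf Q y).card = Q.card + (Q.card - (restrict Q (agree x y)).card) := by
  have h := card_union_add_card_inter (edgesOf Q x) (edgesOf Q y)
  rw [edgesOf_inter hP hx hy hQ, card_edgesOf hP hx, card_edgesOf hP hy,
    card_edgesOf hP hx] at h
  have : (restrict Q (agree x y)).card ≤ Q.card := card_filter_le _ _
  omega

/-- Pairs of tuples weighted by the probability of both, sorted by the set of agreement. -/
lemma sum_pairs_le (hP : ∀ i j, i ≠ j → Disjoint (P i) (P j))
    {T : Finset (κ → V)} (hT : ∀ x ∈ T, ∀ i, x i ∈ P i) {Q : Finset (Sym2 κ)}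
    (hQ : ∀ e ∈ Q, ¬ e.IsDiag) {p δ : ℝ} (hp : 0 ≤ p) (hδ : 0 ≤ δ) (m : ℕ)
    (hc : ∀ A : Finset κ, m ≤ A.card → A ≠ univ → ∀ x ∈ T,
      ((T.filter fun y => ∀ i ∈ A, y i = x i).card : ℝ) *
        p ^ (Q.card - (restrict Q A).card) ≤ δ) :
    ∑ x ∈ T, ∑ y ∈ T with y ≠ x ∧ m ≤ (agree x y).card,
      p ^ (edgesOf Q x ∪ edgesOf Q y).card ≤
      2 ^ Fintype.card κ * δ * (T.card * p ^ Q.card) := by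
  have key : ∀ x ∈ T, ∑ y ∈ T with y ≠ x ∧ m ≤ (agree x y).card,
      p ^ (edgesOf Q x ∪ edgesOf Q y).card ≤ 2 ^ Fintype.card κ * δ * p ^ Q.card := by
    intro x hx
    rw [← sum_fiberwise (g := fun y => agree x y)]
    have : ∀ A ∈ (univ : Finset (Finset κ)),
        ∑ y ∈ (T.filter fun y => y ≠ x ∧ m ≤ (agree x y).card) with agree x y = A,
          p ^ (edgesOf Q x ∪ edgesOf Q y).card ≤ δ * p ^ Q.card := by
      intro A _
      -- A member of the fibre is what makes `hc` applicable: it shows m ≤ |A|, and A ≠ univ because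
      -- it differs from x.
      rcases eq_empty_or_nonempty
        ((T.filter fun y => y ≠ x ∧ m ≤ (agree x y).card).filter fun y => agree x y = A)
        with he | ⟨y0, hy0⟩
      · rw [he, sum_empty]; positivity
      · simp only [mem_filter] at hy0
        obtain ⟨⟨hy0T, hne, hm⟩, rfl⟩ := hy0
        have hu : agree x y0 ≠ univ := fun h =>
          hne (funext fun i => (mem_agree.1 (h ▸ mem_univ i)).symm)
        have h1 := hc _ hm hu x hx
        -- Agreement exactly on A is relaxed to agreement at least on A.
        calc _ ≤ ∑ y ∈ T.filter (fun y => ∀ i ∈ agree x y0, y i = x i),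
              p ^ (Q.card - (restrict Q (agree x y0)).card) * p ^ Q.card := by
              rw [filter_filter]
              refine (sum_le_sum (g := fun _ =>
                p ^ (Q.card - (restrict Q (agree x y0)).card) * p ^ Q.card) ?_).trans
                (sum_le_sum_of_subset_of_nonneg ?_ fun _ _ _ => by positivity)
              · intro y hy
                simp only [mem_filter] at hy
                rw [card_edgesOf_union hP (hT x hx) (hT y hy.1) hQ, hy.2.2, pow_add, mul_comm]
              · intro y hy
                simp only [mem_filter] at hy ⊢
                refine ⟨hy.1, fun i hi => ?_⟩
                rw [← hy.2.2, mem_agree] at hi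
                exact hi.symm
          _ ≤ δ * p ^ Q.card := by
              rw [sum_const, nsmul_eq_mul, ← mul_assoc]
              gcongr
    refine (sum_le_sum this).trans (le_of_eq ?_)
    rw [sum_const, card_univ, Fintype.card_finset, nsmul_eq_mul]
    push_cast; ring
  refine (sum_le_sum key).trans (le_of_eq ?_)
  rw [sum_const, nsmul_eq_mul]
  ring

variable [Fintype V]

/-- Conflict means sharing a vertex, that is, agreeing at some index, so every nonempty proper
agreement set matters. In `hc`, δ bounds the expected number of tuples present that agree with x on
A, given the edges of x. -/
lemma tuple_deletion (hP : ∀ i j, i ≠ j → Disjoint (P i) (P j))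
    {T : Finset (κ → V)} (hT : ∀ x ∈ T, ∀ i, x i ∈ P i) {Q : Finset (Sym2 κ)}
    (hQ : ∀ e ∈ Q, ¬ e.IsDiag) {p δ : ℝ} (hp : 0 < p) (hp1 : p ≤ 1) (hδ : 0 ≤ δ)
    (hδ1 : 2 ^ Fintype.card κ * δ ≤ 1)
    (hc : ∀ A : Finset κ, 1 ≤ A.card → A ≠ univ → ∀ x ∈ T,
      ((T.filter fun y => ∀ i ∈ A, y i = x i).card : ℝ) *
        p ^ (Q.card - (restrict Q A).card) ≤ δ)
    (hne : T.Nonempty) {g : ℕ} (hg : (g : ℝ) ≤ T.card * p ^ Q.card / 4) :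
    pr (edgeProb V p) (fun S => ¬ ∃ J ⊆ T, J.card = g ∧ (∀ x ∈ J, edgesOf Q x ⊆ S) ∧
      ∀ x ∈ J, ∀ y ∈ J, x ≠ y → ∀ i, x i ≠ y i) ≤
      8 / (T.card * p ^ Q.card) + 4 * 2 ^ Fintype.card κ * δ := by
  classical
  set μ : ℝ := T.card * p ^ Q.card with hμ
  have hTc : (0 : ℝ) < T.card := by exact_mod_cast hne.card_pos
  have hμ0 : 0 < μ := by positivity
  have hsum := sum_pairs_le hP hT hQ hp.le hδ 1 hc
  have hprod : ∀ x ∈ T, ∀ y ∈ T, ∏ e ∈ edgesOf Q x ∪ edgesOf Q y, edgeProb V p e =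
      p ^ (edgesOf Q x ∪ edgesOf Q y).card := by
    intro x hx y hy
    refine prod_edgeProb fun e he => ?_
    rcases mem_union.1 he with he | he
    · exact not_isDiag_of_mem_edgesOf hP (hT x hx) hQ e he
    · exact not_isDiag_of_mem_edgesOf hP (hT y hy) hQ e he
  have hd := deletion (edgeProb_nonneg hp.le) (edgeProb_le_one hp1) T (edgesOf Q)
    (fun x y => 1 ≤ (agree x y).card) ?_ hμ0 ?_
    (Λ := 2 ^ Fintype.card κ * δ * μ) ?_ hg
  · have hle : 4 * (μ + 2 ^ Fintype.card κ * δ * μ) / μ ^ 2 +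
        4 * (2 ^ Fintype.card κ * δ * μ) / μ ≤ 8 / μ + 4 * 2 ^ Fintype.card κ * δ := by
      have e1 : 4 * (μ + 2 ^ Fintype.card κ * δ * μ) / μ ^ 2 =
          4 * (1 + 2 ^ Fintype.card κ * δ) / μ := by
        field_simp
      have e2 : 4 * (2 ^ Fintype.card κ * δ * μ) / μ = 4 * 2 ^ Fintype.card κ * δ := by
        field_simp
      rw [e1, e2]
      gcongr
      linarith
    refine le_trans (pr_mono (edgeProb_nonneg hp.le) (edgeProb_le_one hp1) ?_) (hd.trans hle)
    rintro S hS ⟨J, hJT, hJ, hJS, hJd⟩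
    refine hS ⟨J, hJT, hJ, hJS, fun x hx y hy hxy i hi => hJd x hx y hy hxy ?_⟩
    exact card_pos.2 ⟨i, mem_agree.2 hi⟩
  · intro x hx y hy _ hxy
    rw [disjoint_iff_inter_eq_empty, edgesOf_inter hP (hT x hx) (hT y hy) hQ]
    have : agree x y = ∅ := by
      rw [← card_eq_zero]; omega
    rw [this]
    simp [restrict, pairs, edgesOf]
  · rw [hμ, ← nsmul_eq_mul, ← sum_const]
    refine sum_congr rfl fun x hx => ?_
    rw [prod_edgeProb (not_isDiag_of_mem_edgesOf hP (hT x hx) hQ), card_edgesOf hP (hT x hx)]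
  · refine le_trans (le_of_eq ?_) hsum
    refine sum_congr rfl fun x hx => sum_congr rfl fun y hy => ?_
    exact hprod x hx y (mem_filter.1 hy).1

/-- Tuples agreeing at most at one index share no edge, so only agreement sets of size at least 2
enter. The bound on δ makes the correlation term at most half the mean. -/
lemma tuple_janson (hP : ∀ i j, i ≠ j → Disjoint (P i) (P j))
    {T : Finset (κ → V)} (hT : ∀ x ∈ T, ∀ i, x i ∈ P i) {Q : Finset (Sym2 κ)}
    (hQ : ∀ e ∈ Q, ¬ e.IsDiag) {p δ : ℝ} (hp : 0 < p) (hp1 : p ≤ 1) (hδ : 0 ≤ δ)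
    (hδ1 : 2 ^ Fintype.card κ * δ ≤ 1 / 2)
    (hc : ∀ A : Finset κ, 2 ≤ A.card → A ≠ univ → ∀ x ∈ T,
      ((T.filter fun y => ∀ i ∈ A, y i = x i).card : ℝ) *
        p ^ (Q.card - (restrict Q A).card) ≤ δ) :
    pr (edgeProb V p) (fun S => ∀ x ∈ T, ¬ edgesOf Q x ⊆ S) ≤
      Real.exp (-(T.card * p ^ Q.card) / 2) := by
  classical
  have hsum := sum_pairs_le hP hT hQ hp.le hδ 2 hc
  refine (janson (edgeProb_nonneg hp.le) (edgeProb_le_one hp1) T (edgesOf Q)).trans ?_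
  refine Real.exp_le_exp.2 ?_
  have e1 : ∑ x ∈ T, ∏ e ∈ edgesOf Q x, edgeProb V p e = T.card * p ^ Q.card := by
    rw [← nsmul_eq_mul, ← sum_const]
    refine sum_congr rfl fun x hx => ?_
    rw [prod_edgeProb (not_isDiag_of_mem_edgesOf hP (hT x hx) hQ), card_edgesOf hP (hT x hx)]
  have e2 : ∑ x ∈ T, ∑ y ∈ T with y ≠ x ∧ ¬ Disjoint (edgesOf Q x) (edgesOf Q y),
      ∏ e ∈ edgesOf Q x ∪ edgesOf Q y, edgeProb V p e ≤
      2 ^ Fintype.card κ * δ * (T.card * p ^ Q.card) := by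
    refine le_trans (sum_le_sum fun x hx => ?_) hsum
    refine (sum_le_sum_of_subset_of_nonneg (t := T.filter fun y => y ≠ x ∧
      2 ≤ (agree x y).card) ?_ fun y _ _ => prod_nonneg fun e _ =>
        edgeProb_nonneg hp.le e).trans (le_of_eq ?_)
    · intro y hy
      simp only [mem_filter] at hy ⊢
      refine ⟨hy.1, hy.2.1, ?_⟩
      by_contra hlt
      apply hy.2.2
      rw [disjoint_iff_inter_eq_empty, edgesOf_inter hP (hT x hx) (hT y hy.1) hQ]
      have h0 : pairs (agree x y) = ∅ := by
        rw [← card_eq_zero, card_pairs]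
        exact Nat.choose_eq_zero_of_lt (by omega)
      simp [restrict, h0, edgesOf]
    · refine sum_congr rfl fun y hy => ?_
      refine prod_edgeProb fun e he => ?_
      rcases mem_union.1 he with he | he
      · exact not_isDiag_of_mem_edgesOf hP (hT x hx) hQ e he
      · exact not_isDiag_of_mem_edgesOf hP (hT y (mem_filter.1 hy).1) hQ e he
  rw [e1]
  have : 0 ≤ (T.card : ℝ) * p ^ Q.card := by positivity
  nlinarith

end Tuples

end RandomSubset

/-- A family of pairwise disjoint `k`-cliques. -/
def SimpleGraph.IsCliquePacking {V : Type*} (H : SimpleGraph V) (k : ℕ)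
    (K : Finset (Finset V)) : Prop :=
  (∀ A ∈ K, H.IsNClique k A) ∧ ∀ A ∈ K, ∀ B ∈ K, A ≠ B → Disjoint A B

namespace RandomSubset

/-! ### Counting tuples, and packings obtained from them -/

section Counting

variable {V κ : Type*} [DecidableEq V] [Fintype κ] [DecidableEq κ]

lemma not_isDiag_of_mem_pairs {A : Finset κ} : ∀ e ∈ pairs A, ¬ e.IsDiag := by
  intro e he
  induction e using Sym2.ind with
  | _ i j =>
    rw [mk_mem_pairs] at he
    simpa using he.2.2

lemma restrict_pairs_univ (A : Finset κ) : restrict (pairs univ) A = pairs A := by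
  ext e
  induction e using Sym2.ind with
  | _ i j =>
    simp only [restrict, mem_filter, mk_mem_pairs]
    simp

lemma restrict_pairs_erase (A : Finset κ) (e : Sym2 κ) :
    restrict ((pairs univ).erase e) A = (pairs A).erase e := by
  rw [← restrict_pairs_univ A, restrict, restrict, filter_erase]

lemma card_piFinset_pinned {P : κ → Finset V} {u : ℕ} {B : Finset κ}
    (hB : ∀ i, i ∉ B → (P i).card = u) (f : κ → V) :
    (Fintype.piFinset fun i => if i ∈ B then {f i} else P i).card =
      u ^ (Fintype.card κ - B.card) := by
  rw [Fintype.card_piFinset, ← card_compl, ← prod_const, ← prod_subset (subset_univ Bᶜ)]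
  · refine prod_congr rfl fun i hi => ?_
    rw [if_neg (mem_compl.1 hi), hB i (mem_compl.1 hi)]
  · intro i _ hi
    rw [if_pos (by simpa using hi), card_singleton]

lemma card_agreeing_le {P : κ → Finset V} {u : ℕ} (hu : ∀ i, (P i).card = u) (A : Finset κ)
    (x : κ → V) :
    ((Fintype.piFinset P).filter fun y => ∀ i ∈ A, y i = x i).card ≤
      u ^ (Fintype.card κ - A.card) := by
  rw [← card_piFinset_pinned (B := A) (fun i _ => hu i) x]
  refine card_le_card fun y hy => ?_
  simp only [mem_filter, Fintype.mem_piFinset] at hy ⊢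
  intro i
  split_ifs with h
  · simp [hy.2 i h]
  · exact hy.1 i

/-- The tuples whose coordinates at `a` and `b` form a pair in `E`. -/
def tuplesOver (P : κ → Finset V) (a b : κ) (E : Finset (V × V)) : Finset (κ → V) :=
  (Fintype.piFinset P).filter fun y => (y a, y b) ∈ E

/-- A tuple is determined by its edge over (a, b), which has to fit x on A, and by its coordinates
outside A ∪ {a, b}. -/
lemma card_tuplesOver_agreeing_le {P : κ → Finset V} {u : ℕ} {a b : κ} (hab : a ≠ b)
    (hu : ∀ i, i ≠ a → i ≠ b → (P i).card = u) (E : Finset (V × V)) (A : Finset κ) (x : κ → V) :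
    ((tuplesOver P a b E).filter fun y => ∀ i ∈ A, y i = x i).card ≤
      (E.filter fun e => (a ∈ A → e.1 = x a) ∧ (b ∈ A → e.2 = x b)).card *
      u ^ (Fintype.card κ - (A ∪ {a, b}).card) := by
  set E' := E.filter fun e => (a ∈ A → e.1 = x a) ∧ (b ∈ A → e.2 = x b)
  set f : V × V → κ → V := fun e i => if i = a then e.1 else if i = b then e.2 else x i
  have hsub : ((tuplesOver P a b E).filter fun y => ∀ i ∈ A, y i = x i) ⊆
      E'.biUnion fun e =>
        Fintype.piFinset fun i => if i ∈ A ∪ {a, b} then {f e i} else P i := by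
    intro y hy
    simp only [tuplesOver, mem_filter, Fintype.mem_piFinset, mem_biUnion, E'] at hy ⊢
    refine ⟨(y a, y b), ⟨hy.1.2, fun h => hy.2 a h, fun h => hy.2 b h⟩, fun i => ?_⟩
    split_ifs with h
    · rw [mem_singleton]
      simp only [f]
      split_ifs with h1 h2
      · rw [h1]
      · rw [h2]
      · refine hy.2 i ?_
        simpa [h1, h2] using h
    · exact hy.1.1 i
  refine (card_le_card hsub).trans (card_biUnion_le.trans (le_of_eq ?_))
  rw [sum_const_nat]
  intro e _
  refine card_piFinset_pinned (fun i hi => hu i ?_ ?_) _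
  · rintro rfl; simp at hi
  · rintro rfl; simp at hi

lemma card_tuplesOver {P : κ → Finset V} {u : ℕ} {a b : κ} (hab : a ≠ b)
    (hu : ∀ i, i ≠ a → i ≠ b → (P i).card = u) {E : Finset (V × V)}
    (hE : ∀ e ∈ E, e.1 ∈ P a ∧ e.2 ∈ P b) :
    (tuplesOver P a b E).card = E.card * u ^ (Fintype.card κ - 2) := by
  set f : V × V → κ → V := fun e i => if i = a then e.1 else e.2
  have heq : tuplesOver P a b E = E.biUnion fun e =>
      Fintype.piFinset fun i => if i ∈ ({a, b} : Finset κ) then {f e i} else P i := by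
    ext y
    simp only [tuplesOver, mem_filter, Fintype.mem_piFinset, mem_biUnion]
    constructor
    · rintro ⟨hy, hE⟩
      refine ⟨_, hE, fun i => ?_⟩
      split_ifs with h
      · rw [mem_singleton]
        rcases mem_insert.1 h with rfl | h
        · simp [f]
        · rw [mem_singleton.1 h]; simp [f, hab.symm]
      · exact hy i
    · rintro ⟨e, he, hy⟩
      have ha : y a = e.1 := by simpa [f] using hy a
      have hb : y b = e.2 := by simpa [f, hab.symm] using hy b
      refine ⟨fun i => ?_, by rw [ha, hb]; exact he⟩
      by_cases hia : i = a
      · rw [hia, ha]; exact (hE e he).1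
      · by_cases hib : i = b
        · rw [hib, hb]; exact (hE e he).2
        · have := hy i
          simpa [hia, hib] using this
  rw [heq, card_biUnion, sum_const_nat]
  · intro e _
    rw [card_piFinset_pinned (u := u), card_pair hab]
    intro i hi
    simp only [mem_insert, mem_singleton, not_or] at hi
    exact hu i hi.1 hi.2
  · intro e _ e' _ hne
    refine disjoint_left.2 fun y hy hy' => ?_
    rw [Fintype.mem_piFinset] at hy hy'
    apply hne
    have ha : y a = e.1 := by simpa [f] using hy a
    have hb : y b = e.2 := by simpa [f, hab.symm] using hy b
    have ha' : y a = e'.1 := by simpa [f] using hy' a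
    have hb' : y b = e'.2 := by simpa [f, hab.symm] using hy' b
    exact Prod.ext (ha.symm.trans ha') (hb.symm.trans hb')

/-- Tuples differing at every index have disjoint images; these are distinct sets because `κ` is
nonempty. -/
lemma exists_packing_of_tuples [Nonempty κ] {P : κ → Finset V}
    (hP : ∀ i j, i ≠ j → Disjoint (P i) (P j)) {J : Finset (κ → V)}
    (hJ : ∀ x ∈ J, ∀ i, x i ∈ P i) {H : SimpleGraph V}
    (hH : ∀ x ∈ J, ∀ i j, i ≠ j → H.Adj (x i) (x j))
    (hd : ∀ x ∈ J, ∀ y ∈ J, x ≠ y → ∀ i, x i ≠ y i) {Z : Finset V} (hZ : ∀ i, P i ⊆ Z) :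
    ∃ K : Finset (Finset V), H.IsCliquePacking (Fintype.card κ) K ∧ K.card = J.card ∧
      ∀ A ∈ K, A ⊆ Z := by
  have hdis : ∀ x ∈ J, ∀ y ∈ J, x ≠ y →
      Disjoint ((univ : Finset κ).image x) ((univ : Finset κ).image y) := by
    intro x hx y hy hxy
    rw [disjoint_left]
    intro v hv hv'
    obtain ⟨i, -, rfl⟩ := mem_image.1 hv
    obtain ⟨j, -, hj⟩ := mem_image.1 hv'
    have := index_eq hP (hJ y hy) (hJ x hx) hj
    subst this
    exact hd x hx y hy hxy _ hj.symm
  refine ⟨J.image fun x => univ.image x, ⟨?_, ?_⟩, ?_, ?_⟩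
  · intro A hA
    obtain ⟨x, hx, rfl⟩ := mem_image.1 hA
    refine ⟨?_, ?_⟩
    · intro v hv w hw hvw
      simp only [coe_image, coe_univ, Set.image_univ, Set.mem_range] at hv hw
      obtain ⟨i, rfl⟩ := hv
      obtain ⟨j, rfl⟩ := hw
      exact hH x hx i j fun h => hvw (by rw [h])
    · rw [card_image_of_injective _ fun i j h => index_eq hP (hJ x hx) (hJ x hx) h, card_univ]
  · intro A hA B hB hAB
    obtain ⟨x, hx, rfl⟩ := mem_image.1 hA
    obtain ⟨y, hy, rfl⟩ := mem_image.1 hB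
    exact hdis x hx y hy fun h => hAB (by rw [h])
  · refine card_image_of_injOn fun x hx y hy h => ?_
    by_contra hxy
    have h1 := hdis x hx y hy hxy
    rw [show univ.image x = univ.image y from h, disjoint_self_iff_empty] at h1
    simp [univ_eq_empty_iff] at h1
  · intro A hA v hv
    obtain ⟨x, hx, rfl⟩ := mem_image.1 hA
    obtain ⟨i, -, rfl⟩ := mem_image.1 hv
    exact hZ i (hJ x hx i)

end Counting

/-! ### Probability bounds for packings and for single cliques -/

section Estimates

lemma choose_succ_two (s : ℕ) : (s + 1).choose 2 = s.choose 2 + s := by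
  rw [Nat.choose_succ_succ' s 1, Nat.choose_one_right]; ring

/-- Among the subpatterns of a clique minus an edge, single vertices dominate. -/
lemma pow_mul_pow_le {u s k : ℕ} {p : ℝ} (hp : 0 < p) (hp1 : p ≤ 1) (hk : 1 ≤ k) (hks : k ≤ s)
    (hu : 1 ≤ (u : ℝ) ^ 2 * p ^ s) :
    (u : ℝ) ^ (s - k) * p ^ ((s + 1).choose 2 - 1 - k.choose 2) ≤
      (u : ℝ) ^ (s - 1) * p ^ ((s + 1).choose 2 - 1) := by
  have hc : k.choose 2 ≤ (s + 1).choose 2 - 1 := by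
    have := Nat.choose_le_choose 2 hks
    rw [choose_succ_two]; omega
  -- Squaring removes the half in C(k,2): the square is (u² p^k)^(k-1), and u² p^k ≥ u² p^s ≥ 1 as k
  -- ≤ s.
  have h1 : (1 : ℝ) ≤ (u : ℝ) ^ (k - 1) * p ^ k.choose 2 := by
    have h2 : (1 : ℝ) ≤ ((u : ℝ) ^ (k - 1) * p ^ k.choose 2) ^ 2 := by
      have e : ((u : ℝ) ^ (k - 1) * p ^ k.choose 2) ^ 2 = ((u : ℝ) ^ 2 * p ^ k) ^ (k - 1) := by
        rw [mul_pow, mul_pow, ← pow_mul, ← pow_mul, ← pow_mul, ← pow_mul, Nat.choose_two_right,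
          Nat.div_mul_cancel (Nat.even_mul_pred_self k).two_dvd, mul_comm 2 (k - 1)]
      rw [e]
      refine one_le_pow₀ (hu.trans ?_)
      gcongr ?_ * ?_
      exact pow_le_pow_of_le_one hp.le hp1 hks
    have h3 : 0 ≤ (u : ℝ) ^ (k - 1) * p ^ k.choose 2 := by positivity
    nlinarith
  calc (u : ℝ) ^ (s - k) * p ^ ((s + 1).choose 2 - 1 - k.choose 2)
      ≤ (u : ℝ) ^ (s - k) * p ^ ((s + 1).choose 2 - 1 - k.choose 2) *
        ((u : ℝ) ^ (k - 1) * p ^ k.choose 2) := le_mul_of_one_le_right (by positivity) h1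
    _ = (u : ℝ) ^ (s - k + (k - 1)) *
        p ^ ((s + 1).choose 2 - 1 - k.choose 2 + k.choose 2) := by
        rw [pow_add, pow_add]; ring
    _ = _ := by rw [Nat.sub_add_cancel hc, show s - k + (k - 1) = s - 1 by omega]

end Estimates

section Applications

variable {V : Type*} [Fintype V] [DecidableEq V]

lemma adj_of_edgesOf_subset {κ : Type*} [Fintype κ] [DecidableEq κ] {Q : Finset (Sym2 κ)}
    {x : κ → V} {S : Finset (Sym2 V)} (h : edgesOf Q x ⊆ S) {i j : κ} (hij : s(i, j) ∈ Q)
    (hne : x i ≠ x j) : (SimpleGraph.fromEdgeSet (S : Set (Sym2 V))).Adj (x i) (x j) := by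
  rw [SimpleGraph.fromEdgeSet_adj]
  refine ⟨?_, hne⟩
  exact_mod_cast h (mem_image.2 ⟨s(i, j), hij, rfl⟩)

/-- Packings made of random edges only. -/
lemma pr_not_packing_le_of_parts {s u g : ℕ} {p : ℝ} (hs : 1 ≤ s) (hp : 0 < p) (hp1 : p ≤ 1)
    (hu : 1 ≤ (u : ℝ) ^ 2 * p ^ s) {P : Fin (s + 1) → Finset V}
    (hP : ∀ i j, i ≠ j → Disjoint (P i) (P j)) (hPu : ∀ i, (P i).card = u) {Z : Finset V}
    (hZ : ∀ i, P i ⊆ Z)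
    (hδ : 2 ^ (s + 1) * (u * p * ((u : ℝ) ^ (s - 1) * p ^ ((s + 1).choose 2 - 1))) ≤ 1)
    (hg : (g : ℝ) ≤ (u : ℝ) ^ (s + 1) * p ^ (s + 1).choose 2 / 4) (G : SimpleGraph V) :
    pr (edgeProb V p) (fun S => ¬ ∃ K : Finset (Finset V),
      (G ⊔ SimpleGraph.fromEdgeSet (S : Set (Sym2 V))).IsCliquePacking (s + 1) K ∧ K.card = g ∧
        ∀ A ∈ K, A ⊆ Z) ≤
      8 / ((u : ℝ) ^ (s + 1) * p ^ (s + 1).choose 2) +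
        4 * 2 ^ (s + 1) * (u * p * ((u : ℝ) ^ (s - 1) * p ^ ((s + 1).choose 2 - 1))) := by
  have hT : ∀ x ∈ Fintype.piFinset P, ∀ i, x i ∈ P i := fun x hx => Fintype.mem_piFinset.1 hx
  have hu0 : 0 < u := by
    rcases Nat.eq_zero_or_pos u with rfl | h
    · norm_num at hu
    · exact h
  have hTc : (Fintype.piFinset P).card = u ^ (s + 1) := by
    rw [Fintype.card_piFinset, prod_congr rfl fun i _ => hPu i]
    simp
  have hQc : (pairs (univ : Finset (Fin (s + 1)))).card = (s + 1).choose 2 := by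
    rw [card_pairs, card_univ, Fintype.card_fin]
  have hc1 : 1 ≤ (s + 1).choose 2 := Nat.choose_pos (by omega)
  have key := tuple_deletion hP hT (Q := pairs univ) not_isDiag_of_mem_pairs hp hp1
    (δ := u * p * ((u : ℝ) ^ (s - 1) * p ^ ((s + 1).choose 2 - 1))) (by positivity)
    (by rwa [Fintype.card_fin]) ?_ (card_pos.1 (by rw [hTc]; positivity)) (g := g)
    (by rw [hTc, hQc]; exact_mod_cast hg)
  · rw [hTc, hQc, Fintype.card_fin] at key
    push_cast at key
    refine (pr_mono (edgeProb_nonneg hp.le) (edgeProb_le_one hp1) ?_).trans key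
    rintro S hS ⟨J, hJT, hJg, hJS, hJd⟩
    obtain ⟨K, hK, hKc, hKZ⟩ := exists_packing_of_tuples hP (J := J)
      (fun x hx => hT x (hJT hx)) (H := G ⊔ SimpleGraph.fromEdgeSet (S : Set (Sym2 V)))
      (fun x hx i j hij => Or.inr (adj_of_edgesOf_subset (hJS x hx)
        (mk_mem_pairs.2 ⟨mem_univ _, mem_univ _, hij⟩)
        fun h => hij (index_eq hP (hT x (hJT hx)) (hT x (hJT hx)) h))) hJd hZ
    rw [Fintype.card_fin] at hK
    exact hS ⟨K, hK, hKc.trans hJg, hKZ⟩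
  · intro A hA hAu x _
    rw [restrict_pairs_univ, hQc, card_pairs]
    have hAs : A.card ≤ s := by
      have := card_lt_univ_of_notMem (s := A) (x := (not_forall.1 fun h =>
        hAu (eq_univ_iff_forall.2 h)).choose)
        (not_forall.1 fun h => hAu (eq_univ_iff_forall.2 h)).choose_spec
      rw [Fintype.card_fin] at this
      omega
    have h1 := (Nat.cast_le (α := ℝ)).2 (card_agreeing_le hPu A x)
    rw [Fintype.card_fin, Nat.cast_pow] at h1
    have hcc : A.card.choose 2 ≤ s.choose 2 := Nat.choose_le_choose 2 hAs
    have hch := choose_succ_two s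
    -- A factor u p is split off, leaving the expression for a clique minus an edge.
    calc _ ≤ (u : ℝ) ^ (s + 1 - A.card) * p ^ ((s + 1).choose 2 - A.card.choose 2) := by gcongr
      _ = u * p * ((u : ℝ) ^ (s - A.card) * p ^ ((s + 1).choose 2 - 1 - A.card.choose 2)) := by
        rw [show s + 1 - A.card = s - A.card + 1 by omega,
          show (s + 1).choose 2 - A.card.choose 2 =
            (s + 1).choose 2 - 1 - A.card.choose 2 + 1 by omega, pow_succ, pow_succ]
        ring
      _ ≤ _ := mul_le_mul_of_nonneg_left (pow_mul_pow_le hp hp1 hA hAs hu) (by positivity)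

/-- Packings using one edge of the given graph in each clique. -/
lemma pr_not_packing_le_of_edges {s u g d : ℕ} {p : ℝ} (hs : 1 ≤ s) (hp : 0 < p) (hp1 : p ≤ 1)
    (hu : 1 ≤ (u : ℝ) ^ 2 * p ^ s) {P : Fin (s + 1) → Finset V}
    (hP : ∀ i j, i ≠ j → Disjoint (P i) (P j)) {a b : Fin (s + 1)} (hab : a ≠ b)
    (hPu : ∀ i, i ≠ a → i ≠ b → (P i).card = u) {Z : Finset V} (hZ : ∀ i, P i ⊆ Z)
    {G : SimpleGraph V} {E : Finset (V × V)} (hE : ∀ e ∈ E, e.1 ∈ P a ∧ e.2 ∈ P b)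
    (hEG : ∀ e ∈ E, G.Adj e.1 e.2) (hd1 : ∀ v, (E.filter fun e => e.1 = v).card ≤ d)
    (hd2 : ∀ v, (E.filter fun e => e.2 = v).card ≤ d) (hE0 : E.Nonempty) {θ : ℝ}
    (hθ : θ = (u : ℝ) ^ (s - 1) * p ^ ((s + 1).choose 2 - 1))
    (hδ : 2 ^ (s + 1) * (E.card * θ / u + d * θ + u * p * θ) ≤ 1)
    (hg : (g : ℝ) ≤ E.card * θ / 4) :
    pr (edgeProb V p) (fun S => ¬ ∃ K : Finset (Finset V),
      (G ⊔ SimpleGraph.fromEdgeSet (S : Set (Sym2 V))).IsCliquePacking (s + 1) K ∧ K.card = g ∧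
        ∀ A ∈ K, A ⊆ Z) ≤
      8 / (E.card * θ) + 4 * 2 ^ (s + 1) * (E.card * θ / u + d * θ + u * p * θ) := by
  have hT : ∀ x ∈ tuplesOver P a b E, ∀ i, x i ∈ P i := fun x hx =>
    Fintype.mem_piFinset.1 (mem_filter.1 hx).1
  have hu0 : 0 < u := by
    rcases Nat.eq_zero_or_pos u with rfl | h
    · norm_num at hu
    · exact h
  have huR : (0 : ℝ) < u := by exact_mod_cast hu0
  have hTc : (tuplesOver P a b E).card = E.card * u ^ (s - 1) := by
    rw [card_tuplesOver hab hPu hE, Fintype.card_fin, Nat.add_sub_add_right s 1 1]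
  set Q := (pairs (univ : Finset (Fin (s + 1)))).erase s(a, b)
  have hQc : Q.card = (s + 1).choose 2 - 1 := by
    rw [card_erase_of_mem (mk_mem_pairs.2 ⟨mem_univ _, mem_univ _, hab⟩), card_pairs, card_univ,
      Fintype.card_fin]
  have hθ0 : 0 < θ := by rw [hθ]; positivity
  have hμ : ((tuplesOver P a b E).card : ℝ) * p ^ Q.card = E.card * θ := by
    rw [hTc, hQc, hθ]; push_cast; ring
  have key := tuple_deletion hP hT (Q := Q)
    (fun e he => not_isDiag_of_mem_pairs e (mem_of_mem_erase he)) hp hp1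
    (δ := E.card * θ / u + d * θ + u * p * θ) (by positivity)
    (by rwa [Fintype.card_fin]) ?_ (card_pos.1 (by
      rw [hTc]; exact Nat.mul_pos hE0.card_pos (by positivity))) (g := g)
    (by rw [hμ]; exact_mod_cast hg)
  · rw [hμ, Fintype.card_fin] at key
    refine (pr_mono (edgeProb_nonneg hp.le) (edgeProb_le_one hp1) ?_).trans key
    rintro S hS ⟨J, hJT, hJg, hJS, hJd⟩
    have hadj : ∀ x ∈ J, ∀ i j, i ≠ j →
        (G ⊔ SimpleGraph.fromEdgeSet (S : Set (Sym2 V))).Adj (x i) (x j) := by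
      intro x hx i j hij
      by_cases he : s(i, j) = s(a, b)
      · have hG := hEG _ (mem_filter.1 (hJT hx)).2
        left
        rcases Sym2.eq_iff.1 he with ⟨rfl, rfl⟩ | ⟨rfl, rfl⟩
        · exact hG
        · exact hG.symm
      · exact Or.inr (adj_of_edgesOf_subset (hJS x hx)
          (mem_erase.2 ⟨he, mk_mem_pairs.2 ⟨mem_univ _, mem_univ _, hij⟩⟩)
          fun h => hij (index_eq hP (hT x (hJT hx)) (hT x (hJT hx)) h))
    obtain ⟨K, hK, hKc, hKZ⟩ := exists_packing_of_tuples hP (J := J)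
      (fun x hx => hT x (hJT hx)) hadj hJd hZ
    rw [Fintype.card_fin] at hK
    exact hS ⟨K, hK, hKc.trans hJg, hKZ⟩
  · intro A hA hAu x hx
    rw [restrict_pairs_erase, hQc]
    obtain ⟨i0, hi0⟩ := not_forall.1 fun h => hAu (eq_univ_iff_forall.2 h)
    have hAs : A.card ≤ s := by
      have := card_lt_univ_of_notMem hi0
      rw [Fintype.card_fin] at this
      omega
    have hcount := card_tuplesOver_agreeing_le hab hPu E A x
    rw [Fintype.card_fin] at hcount
    set E' := E.filter fun e => (a ∈ A → e.1 = x a) ∧ (b ∈ A → e.2 = x b)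
    have hcountR := (Nat.cast_le (α := ℝ)).2 hcount
    rw [Nat.cast_mul, Nat.cast_pow] at hcountR
    have hmain := pow_mul_pow_le hp hp1 hA hAs hu
    rw [← hθ] at hmain
    have hcc : A.card.choose 2 ≤ s.choose 2 := Nat.choose_le_choose 2 hAs
    have hch := choose_succ_two s
    have t1 : 0 ≤ E.card * θ / u := by positivity
    have t2 : 0 ≤ d * θ := by positivity
    have t3 : 0 ≤ u * p * θ := by positivity
    -- At most one edge of E fits x if both ends are pinned, at most d if one is, and all may if
    -- none is. These cases account for the three terms of δ.
    by_cases ha : a ∈ A <;> by_cases hb : b ∈ A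
    · have hAB : A ∪ {a, b} = A := by
        rw [union_eq_left]; intro i hi
        rcases mem_insert.1 hi with rfl | hi
        · exact ha
        · rw [mem_singleton.1 hi]; exact hb
      have hE' : (E'.card : ℝ) ≤ 1 := by
        have : E'.card ≤ 1 := by
          refine card_le_one.2 fun e he e' he' => ?_
          simp only [E', mem_filter] at he he'
          exact Prod.ext ((he.2.1 ha).trans (he'.2.1 ha).symm)
            ((he.2.2 hb).trans (he'.2.2 hb).symm)
        exact_mod_cast this
      have h2 : 2 ≤ A.card := by
        rw [← card_pair hab]
        exact card_le_card (by rw [← hAB]; exact subset_union_right)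
      have h3 : 1 ≤ A.card.choose 2 := Nat.choose_pos h2
      -- The erased pair lies inside A, so A holds one edge of the pattern fewer; this is the source
      -- of the extra factor p.
      rw [card_erase_of_mem (mk_mem_pairs.2 ⟨ha, hb, hab⟩), card_pairs]
      rw [hAB] at hcountR
      calc _ ≤ (1 * (u : ℝ) ^ (s + 1 - A.card)) *
            p ^ ((s + 1).choose 2 - 1 - (A.card.choose 2 - 1)) := by
            gcongr
            exact hcountR.trans (mul_le_mul_of_nonneg_right hE' (by positivity))
        _ = u * p * ((u : ℝ) ^ (s - A.card) * p ^ ((s + 1).choose 2 - 1 - A.card.choose 2)) := by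
          rw [show s + 1 - A.card = s - A.card + 1 by omega,
            show (s + 1).choose 2 - 1 - (A.card.choose 2 - 1) =
              (s + 1).choose 2 - 1 - A.card.choose 2 + 1 by omega, pow_succ, pow_succ]
          ring
        _ ≤ u * p * θ := by gcongr
        _ ≤ _ := by linarith
    · have hAB : (A ∪ {a, b}).card = A.card + 1 := by
        rw [show A ∪ {a, b} = insert b A by ext; simp; grind, card_insert_of_notMem hb]
      have hE' : (E'.card : ℝ) ≤ d := by
        exact_mod_cast (card_le_card (fun e he => by
          simp only [E', mem_filter] at he ⊢; exact ⟨he.1, he.2.1 ha⟩)).trans (hd1 (x a))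
      rw [erase_eq_of_notMem (fun h => hb (mk_mem_pairs.1 h).2.1), card_pairs]
      rw [hAB, show s + 1 - (A.card + 1) = s - A.card by omega] at hcountR
      calc _ ≤ (d * (u : ℝ) ^ (s - A.card)) *
            p ^ ((s + 1).choose 2 - 1 - A.card.choose 2) := by
            gcongr
            exact hcountR.trans (mul_le_mul_of_nonneg_right hE' (by positivity))
        _ ≤ d * θ := by rw [mul_assoc]; gcongr
        _ ≤ _ := by linarith
    · have hAB : (A ∪ {a, b}).card = A.card + 1 := by
        rw [show A ∪ {a, b} = insert a A by ext; simp; grind, card_insert_of_notMem ha]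
      have hE' : (E'.card : ℝ) ≤ d := by
        exact_mod_cast (card_le_card (fun e he => by
          simp only [E', mem_filter] at he ⊢; exact ⟨he.1, he.2.2 hb⟩)).trans (hd2 (x b))
      rw [erase_eq_of_notMem (fun h => ha (mk_mem_pairs.1 h).1), card_pairs]
      rw [hAB, show s + 1 - (A.card + 1) = s - A.card by omega] at hcountR
      calc _ ≤ (d * (u : ℝ) ^ (s - A.card)) *
            p ^ ((s + 1).choose 2 - 1 - A.card.choose 2) := by
            gcongr
            exact hcountR.trans (mul_le_mul_of_nonneg_right hE' (by positivity))
        _ ≤ d * θ := by rw [mul_assoc]; gcongr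
        _ ≤ _ := by linarith
    · have hAB : (A ∪ {a, b}).card = A.card + 2 := by
        rw [card_union_of_disjoint, card_pair hab]
        rw [disjoint_right]
        intro i hi
        rcases mem_insert.1 hi with rfl | hi
        · exact ha
        · rw [mem_singleton.1 hi]; exact hb
      have hAs' : A.card + 2 ≤ s + 1 := by
        rw [← hAB]
        exact (card_le_univ _).trans (by rw [Fintype.card_fin])
      have hE' : (E'.card : ℝ) ≤ E.card := by exact_mod_cast card_filter_le _ _
      rw [erase_eq_of_notMem (fun h => ha (mk_mem_pairs.1 h).1), card_pairs]
      rw [hAB, show s + 1 - (A.card + 2) = s - 1 - A.card by omega] at hcountR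
      calc _ ≤ (E.card * (u : ℝ) ^ (s - 1 - A.card)) *
            p ^ ((s + 1).choose 2 - 1 - A.card.choose 2) := by
            gcongr
            exact hcountR.trans (mul_le_mul_of_nonneg_right hE' (by positivity))
        _ = E.card * ((u : ℝ) ^ (s - A.card) *
            p ^ ((s + 1).choose 2 - 1 - A.card.choose 2)) / u := by
          rw [show s - A.card = s - 1 - A.card + 1 by omega, pow_succ]
          field_simp
        _ ≤ E.card * θ / u := by gcongr
        _ ≤ _ := by linarith

/-- A set with `s` disjoint parts of size `q` is unlikely not to contain a random `s`-clique. -/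
lemma pr_not_clique_le {s q : ℕ} {p : ℝ} (hs : 1 ≤ s) (hp : 0 < p) (hp1 : p ≤ 1)
    {P : Fin s → Finset V} (hP : ∀ i j, i ≠ j → Disjoint (P i) (P j))
    (hPq : ∀ i, (P i).card = q) {Z : Finset V} (hZ : ∀ i, P i ⊆ Z)
    (hδ : (2 : ℝ) ^ (2 * s + 2) * ((q : ℝ) ^ 2 * p ^ (s + 1)) ≤ 1) :
    pr (edgeProb V p) (fun S => ¬ ∃ A ⊆ Z,
      (SimpleGraph.fromEdgeSet (S : Set (Sym2 V))).IsNClique s A) ≤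
      Real.exp (-((q : ℝ) ^ s * p ^ s.choose 2) / 2) := by
  have hT : ∀ x ∈ Fintype.piFinset P, ∀ i, x i ∈ P i := fun x hx => Fintype.mem_piFinset.1 hx
  have hTc : (Fintype.piFinset P).card = q ^ s := by
    rw [Fintype.card_piFinset, prod_congr rfl fun i _ => hPq i]
    simp
  have hQc : (pairs (univ : Finset (Fin s))).card = s.choose 2 := by
    rw [card_pairs, card_univ, Fintype.card_fin]
  -- This δ is chosen so that 2^s δ = 1/2.
  have key := tuple_janson hP hT (Q := pairs univ) not_isDiag_of_mem_pairs hp hp1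
    (δ := (1 / 2) ^ (s + 1)) (by positivity)
    (by rw [Fintype.card_fin, pow_succ, ← mul_assoc, ← mul_pow]; norm_num) ?_
  · rw [hTc, hQc] at key
    push_cast at key
    refine (pr_mono (edgeProb_nonneg hp.le) (edgeProb_le_one hp1) ?_).trans key
    intro S hS x hx hxS
    have : Nonempty (Fin s) := ⟨⟨0, hs⟩⟩
    obtain ⟨K, hK, hKc, hKZ⟩ := exists_packing_of_tuples hP (J := {x})
      (fun y hy => by rw [mem_singleton.1 hy]; exact hT x hx)
      (H := SimpleGraph.fromEdgeSet (S : Set (Sym2 V)))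
      (fun y hy i j hij => by
        rw [mem_singleton.1 hy]
        exact adj_of_edgesOf_subset hxS (mk_mem_pairs.2 ⟨mem_univ _, mem_univ _, hij⟩)
          fun h => hij (index_eq hP (hT x hx) (hT x hx) h))
      (fun y hy z hz hyz => absurd ((mem_singleton.1 hy).trans (mem_singleton.1 hz).symm) hyz) hZ
    rw [card_singleton] at hKc
    obtain ⟨A, rfl⟩ := card_eq_one.1 hKc
    rw [Fintype.card_fin] at hK
    exact hS ⟨A, hKZ A (mem_singleton_self A), hK.1 A (mem_singleton_self A)⟩
  · intro A hA hAu x _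
    rw [restrict_pairs_univ, hQc, card_pairs]
    obtain ⟨i0, hi0⟩ := not_forall.1 fun h => hAu (eq_univ_iff_forall.2 h)
    have hAs : A.card < s := by
      have := card_lt_univ_of_notMem hi0
      rwa [Fintype.card_fin] at this
    have h1 := (Nat.cast_le (α := ℝ)).2 (card_agreeing_le hPq A x)
    rw [Fintype.card_fin, Nat.cast_pow] at h1
    set k := A.card
    clear_value k
    -- Squares again remove the halves. Since k ≥ 2, the base is at most q² p^(s+1), which `hδ`
    -- controls.
    have h2 : ((q : ℝ) ^ (s - k) * p ^ (s.choose 2 - k.choose 2)) ^ 2 =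
        ((q : ℝ) ^ 2 * p ^ (s + k - 1)) ^ (s - k) := by
      rw [mul_pow, mul_pow, ← pow_mul, ← pow_mul, ← pow_mul, ← pow_mul, mul_comm 2 (s - k)]
      congr 2
      have e1 : s.choose 2 * 2 = s * (s - 1) := by
        rw [Nat.choose_two_right, Nat.div_mul_cancel (Nat.even_mul_pred_self s).two_dvd]
      have e2 : k.choose 2 * 2 = k * (k - 1) := by
        rw [Nat.choose_two_right, Nat.div_mul_cancel (Nat.even_mul_pred_self k).two_dvd]
      rw [Nat.sub_mul, e1, e2]
      obtain ⟨j, rfl⟩ : ∃ j, k = j + 1 := ⟨k - 1, by omega⟩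
      obtain ⟨t, rfl⟩ : ∃ t, s = j + 1 + t := ⟨s - (j + 1), by omega⟩
      rw [show j + 1 + t - 1 = j + t by omega, show j + 1 + t + (j + 1) - 1 = 2 * j + 1 + t by omega,
        show j + 1 + t - (j + 1) = t by omega, Nat.add_sub_cancel]
      refine Nat.sub_eq_of_eq_add ?_
      ring
    have h3 : (q : ℝ) ^ 2 * p ^ (s + k - 1) ≤ (1 / 2) ^ (2 * s + 2) := by
      have : (q : ℝ) ^ 2 * p ^ (s + k - 1) ≤ (q : ℝ) ^ 2 * p ^ (s + 1) := by
        gcongr ?_ * ?_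
        exact pow_le_pow_of_le_one hp.le hp1 (by omega)
      refine this.trans ?_
      rw [div_pow, one_pow, le_div_iff₀ (by positivity), mul_comm]
      exact hδ
    have h4 : ((q : ℝ) ^ (s - k) * p ^ (s.choose 2 - k.choose 2)) ^ 2 ≤
        ((1 / 2 : ℝ) ^ (s + 1)) ^ 2 := by
      rw [h2, ← pow_mul, show (s + 1) * 2 = 2 * s + 2 by ring]
      have h5 : (q : ℝ) ^ 2 * p ^ (s + k - 1) ≤ 1 :=
        h3.trans (pow_le_one₀ (by norm_num) (by norm_num))
      have h6 : 0 ≤ (q : ℝ) ^ 2 * p ^ (s + k - 1) := by positivity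
      exact (pow_le_of_le_one h6 h5 (by omega)).trans h3
    calc _ ≤ (q : ℝ) ^ (s - k) * p ^ (s.choose 2 - k.choose 2) := by gcongr
      _ ≤ _ := by
        exact (pow_le_pow_iff_left₀ (by positivity) (by positivity) two_ne_zero).1 h4

end Applications

end RandomSubset

/-! ### Extracting a bipartite graph of controlled degrees -/

namespace RandomSubset

variable {V : Type*} [Fintype V] [DecidableEq V]

/-- Some set of vertices cuts a quarter of a set of oriented edges in the right direction. -/
lemma exists_cut (E : Finset (V × V)) (hE : ∀ e ∈ E, e.1 ≠ e.2) :
    ∃ A : Finset V, E.card ≤ 4 * (E.filter fun e => e.1 ∈ A ∧ e.2 ∉ A).card := by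
  -- A uniformly random set cuts an oriented edge in the right direction with probability 1/4; some
  -- set does at least as well as the average.
  set π : V → ℝ := fun _ => 1 / 2
  set f : Finset V → ℝ := fun S => ∑ e ∈ E,
    (ind (fun S => {e.1} ⊆ S) S - ind (fun S => {e.1, e.2} ⊆ S) S)
  have hf : ∀ S, f S = (E.filter fun e => e.1 ∈ S ∧ e.2 ∉ S).card := by
    intro S
    rw [card_filter]
    push_cast
    refine sum_congr rfl fun e _ => ?_
    simp only [ind, singleton_subset_iff, insert_subset_iff]
    by_cases h1 : e.1 ∈ S <;> by_cases h2 : e.2 ∈ S <;> simp [h1, h2]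
  have hexp : expect π f = E.card / 4 := by
    rw [expect_sum]
    have : ∀ e ∈ E, expect π (fun S => ind (fun S => {e.1} ⊆ S) S -
        ind (fun S => {e.1, e.2} ⊆ S) S) = 1 / 4 := by
      intro e he
      rw [expect_sub]
      have h1 := pr_subset π {e.1}
      have h2 := pr_subset π {e.1, e.2}
      rw [prod_const, card_singleton] at h1
      rw [prod_const, card_pair (hE e he)] at h2
      simp only [pr] at h1 h2
      rw [h1, h2]; norm_num
    rw [sum_congr rfl this]
    simp; ring
  obtain ⟨A, -, hA⟩ := exists_max_image univ f univ_nonempty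
  refine ⟨A, ?_⟩
  have h1 : expect π f ≤ f A := by
    have := expect_mono (π := π) (fun _ => by norm_num [π]) (fun _ => by norm_num [π])
      (fun S => hA S (mem_univ S))
    rwa [expect_const] at this
  rw [hexp, hf] at h1
  have : (E.card : ℝ) ≤ 4 * ((E.filter fun e => e.1 ∈ A ∧ e.2 ∉ A).card : ℕ) := by linarith
  exact_mod_cast this

/-- A set of oriented edges can be thinned by a factor `ρ` in all degrees at once. -/
lemma exists_thinning (E : Finset (V × V)) {ρ d : ℕ}
    (h1 : ∀ v, (E.filter fun e => e.1 = v).card ≤ ρ * d)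
    (h2 : ∀ v, (E.filter fun e => e.2 = v).card ≤ ρ * d) :
    ∃ E' ⊆ E, (∀ v, (E'.filter fun e => e.1 = v).card ≤ d) ∧
      (∀ v, (E'.filter fun e => e.2 = v).card ≤ d) ∧ E.card ≤ (2 * ρ + 1) * E'.card := by
  -- In a largest subset E' with degrees at most d, every omitted edge has a saturated end. If k
  -- vertices on one side are saturated then k d ≤ |E'|, and they meet at most k ρ d ≤ ρ |E'| edges
  -- of E.
  set 𝓕 := E.powerset.filter fun E' => (∀ v, (E'.filter fun e => e.1 = v).card ≤ d) ∧
    (∀ v, (E'.filter fun e => e.2 = v).card ≤ d)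
  have hne : 𝓕.Nonempty := ⟨∅, by simp [𝓕]⟩
  obtain ⟨E', hE', hmax⟩ := exists_max_image 𝓕 card hne
  simp only [𝓕, mem_filter, mem_powerset] at hE'
  obtain ⟨hsub, hd1, hd2⟩ := hE'
  refine ⟨E', hsub, hd1, hd2, ?_⟩
  set L := univ.filter fun v => d ≤ (E'.filter fun e => e.1 = v).card
  set R := univ.filter fun v => d ≤ (E'.filter fun e => e.2 = v).card
  have hcover : E ⊆ E' ∪ (L.biUnion (fun v => E.filter fun e => e.1 = v) ∪
      R.biUnion fun v => E.filter fun e => e.2 = v) := by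
    intro e he
    by_contra hcon
    simp only [mem_union, mem_biUnion, mem_filter, not_or, not_exists, not_and, L, R, mem_univ,
      true_and] at hcon
    obtain ⟨heE', hl, hr⟩ := hcon
    have hl' : (E'.filter fun e' => e'.1 = e.1).card < d := by
      by_contra h; exact hl e.1 (not_lt.1 h) he rfl
    have hr' : (E'.filter fun e' => e'.2 = e.2).card < d := by
      by_contra h; exact hr e.2 (not_lt.1 h) he rfl
    have := hmax (insert e E') ?_
    · rw [card_insert_of_notMem heE'] at this; omega
    · simp only [𝓕, mem_filter, mem_powerset]
      refine ⟨insert_subset he hsub, fun v => ?_, fun v => ?_⟩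
      · rw [filter_insert]
        split_ifs with h
        · subst h
          exact (card_insert_le _ _).trans hl'
        · exact hd1 v
      · rw [filter_insert]
        split_ifs with h
        · subst h
          exact (card_insert_le _ _).trans hr'
        · exact hd2 v
  have hL : L.card * d ≤ E'.card := by
    rw [card_eq_sum_card_fiberwise (f := Prod.fst) (t := univ) (s := E') fun _ _ => by simp,
      ← smul_eq_mul, ← sum_const]
    exact (sum_le_sum fun v hv => (mem_filter.1 hv).2).trans
      (sum_le_sum_of_subset (subset_univ L))
  have hR : R.card * d ≤ E'.card := by
    rw [card_eq_sum_card_fiberwise (f := Prod.snd) (t := univ) (s := E') fun _ _ => by simp,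
      ← smul_eq_mul, ← sum_const]
    exact (sum_le_sum fun v hv => (mem_filter.1 hv).2).trans
      (sum_le_sum_of_subset (subset_univ R))
  have hb1 : (L.biUnion fun v => E.filter fun e => e.1 = v).card ≤ L.card * (ρ * d) :=
    card_biUnion_le_card_mul _ _ _ fun v _ => h1 v
  have hb2 : (R.biUnion fun v => E.filter fun e => e.2 = v).card ≤ R.card * (ρ * d) :=
    card_biUnion_le_card_mul _ _ _ fun v _ => h2 v
  have := (card_le_card hcover).trans ((card_union_le _ _).trans
    (Nat.add_le_add_left (card_union_le _ _) _))
  have k1 := Nat.mul_le_mul_left ρ hL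
  have k2 := Nat.mul_le_mul_left ρ hR
  calc E.card ≤ E'.card + (L.card * (ρ * d) + R.card * (ρ * d)) := by omega
    _ = E'.card + (ρ * (L.card * d) + ρ * (R.card * d)) := by ring
    _ ≤ E'.card + (ρ * E'.card + ρ * E'.card) := by omega
    _ = _ := by ring

lemma exists_disjoint_parts {U : Finset V} {r u : ℕ} (h : r * u ≤ U.card) :
    ∃ P : Fin r → Finset V, (∀ i j, i ≠ j → Disjoint (P i) (P j)) ∧ (∀ i, (P i).card = u) ∧
      ∀ i, P i ⊆ U := by
  obtain ⟨f⟩ : Nonempty (Fin r × Fin u ↪ U) :=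
    Function.Embedding.nonempty_of_card_le (by simpa using h)
  refine ⟨fun i => univ.image fun j => (f (i, j) : V), fun i j hij => ?_, fun i => ?_, fun i => ?_⟩
  · rw [disjoint_left]
    intro v hv hv'
    obtain ⟨k, -, rfl⟩ := mem_image.1 hv
    obtain ⟨l, -, hl⟩ := mem_image.1 hv'
    have := f.injective (Subtype.ext hl)
    exact hij (Prod.ext_iff.1 this).1.symm
  · rw [card_image_of_injective, card_univ, Fintype.card_fin]
    intro k l hkl
    exact (Prod.ext_iff.1 (f.injective (Subtype.ext hkl))).2
  · intro v hv
    obtain ⟨k, -, rfl⟩ := mem_image.1 hv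
    exact (f (i, k)).2

open Classical in
/-- Edges of `G`, oriented from `X` to `Y`. -/
noncomputable def edgesBetween (G : SimpleGraph V) (X Y : Finset V) : Finset (V × V) :=
  (X ×ˢ Y).filter fun e => G.Adj e.1 e.2

lemma mem_edgesBetween {G : SimpleGraph V} {X Y : Finset V} {e : V × V} :
    e ∈ edgesBetween G X Y ↔ (e.1 ∈ X ∧ e.2 ∈ Y) ∧ G.Adj e.1 e.2 := by
  simp [edgesBetween]

lemma card_edgesBetween_comm (G : SimpleGraph V) (X Y : Finset V) :
    (edgesBetween G X Y).card = (edgesBetween G Y X).card := by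
  refine card_bij' (fun e _ => e.swap) (fun e _ => e.swap) ?_ ?_ (by simp) (by simp) <;>
  · intro e he
    simp only [edgesBetween, mem_filter, mem_product, Prod.fst_swap, Prod.snd_swap] at he ⊢
    exact ⟨he.1.symm, he.2.symm⟩

/-- Given two disjoint w-subsets of Y, the end in Y of an edge avoids one of them, so deleting one
of the two keeps half the edges. The deleted one becomes U. -/
lemma exists_reserve (G : SimpleGraph V) {X Y : Finset V} {w : ℕ} (hw : 2 * w ≤ Y.card) :
    ∃ Y' U, Y' ⊆ Y ∧ U ⊆ Y ∧ Disjoint Y' U ∧ U.card = w ∧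
      (edgesBetween G X Y).card ≤ 2 * (edgesBetween G X Y').card := by
  obtain ⟨B1, hB1, hc1⟩ := exists_subset_card_eq (show w ≤ Y.card by omega)
  obtain ⟨B2, hB2, hc2⟩ := exists_subset_card_eq (s := Y \ B1) (n := w)
    (by rw [card_sdiff_of_subset hB1]; omega)
  have hsub : edgesBetween G X Y ⊆ edgesBetween G X (Y \ B1) ∪ edgesBetween G X (Y \ B2) := by
    intro e he
    simp only [edgesBetween, mem_filter, mem_product, mem_union, mem_sdiff] at he ⊢
    by_cases h : e.2 ∈ B1
    · have : e.2 ∉ B2 := fun h2 => (mem_sdiff.1 (hB2 h2)).2 h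
      tauto
    · tauto
  have hcard := (card_le_card hsub).trans (card_union_le _ _)
  rcases le_total (edgesBetween G X (Y \ B1)).card (edgesBetween G X (Y \ B2)).card with h | h
  · exact ⟨Y \ B2, B2, sdiff_subset, hB2.trans sdiff_subset, sdiff_disjoint, hc2, by omega⟩
  · exact ⟨Y \ B1, B1, sdiff_subset, hB1, sdiff_disjoint, hc1, by omega⟩

open Classical in
/-- The neighbours of `v`. -/
noncomputable def nbrs (G : SimpleGraph V) (v : V) : Finset V := univ.filter fun w => G.Adj v w

lemma mem_nbrs {G : SimpleGraph V} {v w : V} : w ∈ nbrs G v ↔ G.Adj v w := by simp [nbrs]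

lemma card_edgesBetween (G : SimpleGraph V) (X Y : Finset V) :
    (edgesBetween G X Y).card = ∑ v ∈ X, (nbrs G v ∩ Y).card := by
  classical
  rw [card_eq_sum_card_fiberwise (f := Prod.fst) (t := X)]
  · refine sum_congr rfl fun v hv => ?_
    refine card_bij' (fun e _ => e.2) (fun w _ => (v, w)) ?_ ?_ ?_ ?_
    · intro e he
      simp only [edgesBetween, mem_filter, mem_product, mem_inter, mem_nbrs] at he ⊢
      obtain ⟨⟨⟨-, h2⟩, h3⟩, rfl⟩ := he
      exact ⟨h3, h2⟩
    · intro w hw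
      simp only [edgesBetween, mem_filter, mem_product, mem_inter, mem_nbrs] at hw ⊢
      exact ⟨⟨⟨hv, hw.2⟩, hw.1⟩, trivial⟩
    · intro e he
      rw [← (mem_filter.1 he).2]
    · intro w _; rfl
  · intro e he
    simp only [edgesBetween, coe_filter, mem_product] at he
    exact he.1.1

/-- In a set of large minimum degree one finds many edges across two disjoint sets, and a third
set in reserve. -/
lemma exists_bipartite (G : SimpleGraph V) {Z : Finset V} {g w : ℕ}
    (hdeg : ∀ v ∈ Z, g ≤ (nbrs G v ∩ Z).card) (hw : 4 * w ≤ Z.card) :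
    ∃ X Y U, X ⊆ Z ∧ Y ⊆ Z ∧ U ⊆ Z ∧ Disjoint X Y ∧ Disjoint X U ∧ Disjoint Y U ∧
      U.card = w ∧ Z.card * g ≤ 8 * (edgesBetween G X Y).card := by
  have hE : Z.card * g ≤ (edgesBetween G Z Z).card := by
    rw [card_edgesBetween, ← smul_eq_mul, ← sum_const]
    exact sum_le_sum hdeg
  obtain ⟨A, hA⟩ := exists_cut (edgesBetween G Z Z) fun e he =>
    (mem_edgesBetween.1 he).2.ne
  have hcut : ((edgesBetween G Z Z).filter fun e => e.1 ∈ A ∧ e.2 ∉ A) =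
      edgesBetween G (Z ∩ A) (Z \ A) := by
    ext e
    simp only [edgesBetween, mem_filter, mem_product, mem_inter, mem_sdiff]
    tauto
  rw [hcut] at hA
  have hcard := card_inter_add_card_sdiff Z A
  have hdisj : Disjoint (Z ∩ A) (Z \ A) := (disjoint_sdiff_inter Z A).symm
  -- The larger side has at least 2w vertices and supplies the reserve. The cut loses a factor 4 and
  -- the reserve a factor 2.
  rcases le_total (Z ∩ A).card (Z \ A).card with h | h
  · obtain ⟨Y, U, hY, hU, hYU, hUc, hle⟩ := exists_reserve G (X := Z ∩ A) (Y := Z \ A) (w := w)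
      (by omega)
    exact ⟨Z ∩ A, Y, U, inter_subset_left, hY.trans sdiff_subset, hU.trans sdiff_subset,
      hdisj.mono_right hY, hdisj.mono_right hU, hYU, hUc, by omega⟩
  · obtain ⟨Y, U, hY, hU, hYU, hUc, hle⟩ := exists_reserve G (X := Z \ A) (Y := Z ∩ A) (w := w)
      (by omega)
    rw [card_edgesBetween_comm G (Z ∩ A)] at hA
    exact ⟨Z \ A, Y, U, sdiff_subset, hY.trans inter_subset_left, hU.trans inter_subset_left,
      hdisj.symm.mono_right hY, hdisj.symm.mono_right hU, hYU, hUc, by omega⟩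

/-! ### Greedy packings and the reduction to moderate degrees -/

section Greedy

variable {G R : SimpleGraph V} {s b : ℕ}

lemma card_union_packing_le {K : Finset (Finset V)} {k : ℕ} (hK : R.IsCliquePacking k K) :
    (K.biUnion id).card ≤ K.card * k :=
  card_biUnion_le_card_mul _ _ _ fun A hA => (hK.1 A hA).card_eq.le

/-- `v` is joined to an s-clique found among its unused neighbours. B collects vertices that must
stay free for later. -/
lemma add_clique (hle : G ≤ R) (hcl : ∀ B : Finset V, b ≤ B.card → ∃ A ⊆ B, R.IsNClique s A)
    {K : Finset (Finset V)} (hK : R.IsCliquePacking (s + 1) K) {B : Finset V}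
    (hKB : ∀ C ∈ K, Disjoint C B) {v : V} (hvB : v ∉ B) (hvK : ∀ C ∈ K, v ∉ C)
    (hN : b ≤ (nbrs G v \ (B ∪ K.biUnion id)).card) :
    ∃ K', R.IsCliquePacking (s + 1) K' ∧ K'.card = K.card + 1 ∧ ∀ C ∈ K', Disjoint C B := by
  obtain ⟨A, hA, hAc⟩ := hcl _ hN
  have hAm : ∀ w ∈ A, G.Adj v w ∧ w ∉ B ∧ ∀ C ∈ K, w ∉ C := by
    intro w hw
    have := hA hw
    simp only [mem_sdiff, mem_union, mem_biUnion, id, not_or, not_exists, not_and, mem_nbrs]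
      at this
    exact ⟨this.1, this.2.1, this.2.2⟩
  have hC : R.IsNClique (s + 1) (insert v A) := hAc.insert fun w hw => hle (hAm w hw).1
  have hCK : ∀ C ∈ K, Disjoint (insert v A) C := by
    intro C hCK
    rw [disjoint_left]
    intro w hw
    rcases mem_insert.1 hw with rfl | hw
    · exact hvK C hCK
    · exact (hAm w hw).2.2 C hCK
  have hnot : insert v A ∉ K := fun h => hvK _ h (mem_insert_self v A)
  refine ⟨insert (insert v A) K, ⟨?_, ?_⟩, card_insert_of_notMem hnot, ?_⟩
  · intro C hC'
    rcases mem_insert.1 hC' with rfl | hC'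
    · exact hC
    · exact hK.1 C hC'
  · intro C hC' D hD hCD
    rcases mem_insert.1 hC' with rfl | hC' <;> rcases mem_insert.1 hD with rfl | hD
    · exact absurd rfl hCD
    · exact hCK D hD
    · exact (hCK C hC').symm
    · exact hK.2 C hC' D hD hCD
  · intro C hC'
    rcases mem_insert.1 hC' with rfl | hC'
    · rw [disjoint_left]
      intro w hw
      rcases mem_insert.1 hw with rfl | hw
      · exact hvB
      · exact (hAm w hw).2.1
    · exact hKB C hC'

/-- Vertices of large degree extend a packing one by one. -/
lemma extend_packing (hle : G ≤ R)
    (hcl : ∀ B : Finset V, b ≤ B.card → ∃ A ⊆ B, R.IsNClique s A) (A B : Finset V)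
    (hAB : Disjoint A B) (K : Finset (Finset V)) (hK : R.IsCliquePacking (s + 1) K)
    (hKAB : ∀ C ∈ K, Disjoint C (A ∪ B))
    (hN : ∀ v ∈ A, (K.card + A.card) * (s + 1) + b ≤ (nbrs G v \ (A ∪ B)).card) :
    ∃ K', R.IsCliquePacking (s + 1) K' ∧ K'.card = K.card + A.card ∧
      ∀ C ∈ K', Disjoint C B := by
  -- The bound in `hN` is invariant: each step moves one unit from `A.card` to `K.card`.
  induction A using Finset.induction_on generalizing K with
  | empty => exact ⟨K, hK, by simp, by simpa using hKAB⟩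
  | insert v A hv ih =>
    have hvB : v ∉ B := disjoint_left.1 hAB (mem_insert_self v A)
    obtain ⟨K', hK', hKc', hKB'⟩ := add_clique hle hcl hK (B := A ∪ B)
      (fun C hC => (hKAB C hC).mono_right (union_subset_union_left (subset_insert v A)))
      (v := v) (by simp [hv, hvB])
      (fun C hC h => disjoint_left.1 (hKAB C hC) h (by simp)) (by
        have h1 := hN v (mem_insert_self v A)
        have h2 := card_union_packing_le hK
        have h3 : (nbrs G v \ (insert v A ∪ B)).card ≤
            (nbrs G v \ (A ∪ B ∪ K.biUnion id)).card + (K.biUnion id).card := by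
          refine (card_le_card (t := (nbrs G v \ (A ∪ B ∪ K.biUnion id)) ∪ K.biUnion id)
            fun w hw => ?_).trans (card_union_le _ _)
          simp only [mem_sdiff, mem_union, mem_insert, not_or] at hw ⊢
          tauto
        have h4 : K.card * (s + 1) ≤ (K.card + (insert v A).card) * (s + 1) :=
          Nat.mul_le_mul_right _ (by omega)
        rw [add_mul] at h1
        omega)
    have hAB' : Disjoint A B := hAB.mono_left (subset_insert v A)
    obtain ⟨K'', h1, h2, h3⟩ := ih hAB' K' hK' hKB' (by
      intro w hw
      have h1 := hN w (mem_insert_of_mem hw)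
      rw [card_insert_of_notMem hv] at h1
      rw [hKc', show K.card + 1 + A.card = K.card + (A.card + 1) by ring]
      refine h1.trans (card_le_card (sdiff_subset_sdiff le_rfl ?_))
      exact union_subset_union_left (subset_insert v A))
    exact ⟨K'', h1, by rw [h2, hKc', card_insert_of_notMem hv]; ring, h3⟩

/-- If the minimum degree outside `H` is much larger than `b`, cliques are found greedily. -/
lemma exists_packing_of_large_degree (hle : G ≤ R)
    (hcl : ∀ B : Finset V, b ≤ B.card → ∃ A ⊆ B, R.IsNClique s A) (H : Finset V) {g Δ : ℕ}
    (hg : ∀ v, v ∉ H → g ≤ (nbrs G v \ H).card) (hΔ : ∀ v, v ∉ H → (nbrs G v).card ≤ Δ)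
    (hb : 4 * b ≤ g) (hsize : 2 * (H.card + g * (s + 1)) ≤ Fintype.card V)
    (hΔn : 4 * ((s + 1) * Δ) ≤ Fintype.card V) (hn : 0 < Fintype.card V) :
    ∃ K, R.IsCliquePacking (s + 1) K ∧ K.card = g ∧ ∀ C ∈ K, Disjoint C H := by
  have key : ∀ j ≤ g, ∃ K, R.IsCliquePacking (s + 1) K ∧ K.card = j ∧ ∀ C ∈ K, Disjoint C H := by
    intro j
    induction j with
    | zero => exact fun _ => ⟨∅, ⟨by simp, by simp⟩, rfl, by simp⟩
    | succ j ih =>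
      intro hj
      obtain ⟨K, hK, hKc, hKH⟩ := ih (by omega)
      set W := K.biUnion id
      have hWc : W.card ≤ g * (s + 1) :=
        (card_union_packing_le hK).trans (Nat.mul_le_mul_right _ (by omega))
      by_cases hex : ∃ v, v ∉ H ∧ v ∉ W ∧ b ≤ (nbrs G v \ (H ∪ W)).card
      · obtain ⟨v, hvH, hvW, hv⟩ := hex
        obtain ⟨K', h1, h2, h3⟩ := add_clique hle hcl hK hKH hvH
          (fun C hC h => hvW (mem_biUnion.2 ⟨C, hC, h⟩)) hv
        exact ⟨K', h1, by omega, h3⟩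
      -- If stuck, every unused vertex outside H sends at least g - b ≥ 3g/4 edges into W. Counting
      -- these from both sides gives 3gn ≤ 8 |W| Δ ≤ 2gn.
      · exfalso
        push Not at hex
        set Y := univ \ (H ∪ W)
        have hY : 2 * Y.card ≥ Fintype.card V := by
          have h1 : Y.card = Fintype.card V - (H ∪ W).card := by
            rw [card_sdiff_of_subset (subset_univ _), card_univ]
          have h2 := card_union_le H W
          omega
        have hlow : Y.card * (g - b) ≤ (edgesBetween G Y W).card := by
          rw [card_edgesBetween, ← smul_eq_mul, ← sum_const]
          refine sum_le_sum fun v hv => ?_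
          simp only [Y, mem_sdiff, mem_union, not_or] at hv
          have h1 := hex v hv.2.1 hv.2.2
          have h2 := hg v hv.2.1
          have h3 : (nbrs G v \ H).card ≤ (nbrs G v \ (H ∪ W)).card + (nbrs G v ∩ W).card := by
            refine (card_le_card fun w hw => ?_).trans (card_union_le _ _)
            simp only [mem_sdiff, mem_union, mem_inter, not_or] at hw ⊢
            tauto
          omega
        have hup : (edgesBetween G Y W).card ≤ W.card * Δ := by
          rw [card_edgesBetween_comm, card_edgesBetween, ← smul_eq_mul, ← sum_const]
          refine sum_le_sum fun v hv => ?_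
          obtain ⟨C, hC, hvC⟩ := mem_biUnion.1 hv
          exact (card_le_card inter_subset_left).trans
            (hΔ v (disjoint_left.1 (hKH C hC) hvC))
        have h1 : W.card * Δ ≤ g * (s + 1) * Δ := Nat.mul_le_mul_right _ hWc
        have h2 : 3 * g ≤ 4 * (g - b) := by omega
        have h3 : Y.card * (3 * g) ≤ Y.card * (4 * (g - b)) := Nat.mul_le_mul_left _ h2
        have h4 : Fintype.card V * (3 * g) ≤ 2 * Y.card * (3 * g) := Nat.mul_le_mul_right _ hY
        have h5 : g * (4 * ((s + 1) * Δ)) ≤ g * Fintype.card V := Nat.mul_le_mul_left _ hΔn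
        have h6 : 0 < Fintype.card V * g := Nat.mul_pos hn (by omega)
        nlinarith
  exact key g le_rfl

/-- Either the clique property alone gives the packing, or it suffices to find a small packing
inside a set that induces a graph of moderate degrees. -/
lemma packing_reduction {g : ℕ} (hG : ∀ v, g ≤ (nbrs G v).card)
    (hg : 32 * (s + 2) ^ 2 * g ≤ Fintype.card V) (hb : 32 * (s + 2) ^ 2 * b ≤ Fintype.card V)
    (hn : 0 < Fintype.card V) :
    (∀ R, G ≤ R → (∀ B : Finset V, b ≤ B.card → ∃ A ⊆ B, R.IsNClique s A) →
      ∃ K, R.IsCliquePacking (s + 1) K ∧ K.card = g) ∨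
    ∃ (Z : Finset V) (g' : ℕ), Fintype.card V ≤ 2 * Z.card ∧ 1 ≤ g' ∧ g' ≤ 4 * b ∧
      (∀ v ∈ Z, g' ≤ (nbrs G v ∩ Z).card ∧ (nbrs G v ∩ Z).card ≤ 8 * (s + 2) * b) ∧
      ∀ R, G ≤ R → (∀ B : Finset V, b ≤ B.card → ∃ A ⊆ B, R.IsNClique s A) →
        (∃ K, R.IsCliquePacking (s + 1) K ∧ K.card = g' ∧ ∀ A ∈ K, A ⊆ Z) →
        ∃ K, R.IsCliquePacking (s + 1) K ∧ K.card = g := by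
  set n := Fintype.card V
  set Δ := n / (8 * (s + 1))
  have hempty : ∀ R : SimpleGraph V, R.IsCliquePacking (s + 1) ∅ := fun R => ⟨by simp, by simp⟩
  have hΔ1 : n < 8 * (s + 1) * (Δ + 1) := by
    have := Nat.lt_mul_div_succ n (show 0 < 8 * (s + 1) by omega)
    exact this
  have hΔ2 : 8 * (s + 1) * Δ ≤ n := Nat.mul_div_le n _
  -- Room for g cliques on s + 1 vertices, g further removed vertices, and b free neighbours.
  have hgΔ : (s + 2) * g + b ≤ Δ := by nlinarith
  set H := univ.filter fun v => Δ < (nbrs G v).card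
  have hsd : ∀ (v : V) (A : Finset V), (nbrs G v).card ≤ (nbrs G v \ A).card + A.card := by
    intro v A
    refine (card_le_card (t := (nbrs G v \ A) ∪ A) fun w hw => ?_).trans (card_union_le _ _)
    simp only [mem_union, mem_sdiff]
    tauto
  by_cases hHg : g ≤ H.card
  · left
    intro R hle hcl
    obtain ⟨A, hA, hAc⟩ := exists_subset_card_eq hHg
    obtain ⟨K, h1, h2, -⟩ := extend_packing hle hcl A ∅ (by simp) ∅ (hempty R) (by simp) (by
      intro v hv
      have h1 := (mem_filter.1 (hA hv)).2
      have h2 := hsd v A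
      rw [card_empty, zero_add, union_empty, hAc]
      rw [hAc] at h2
      nlinarith)
    exact ⟨K, h1, by simpa [hAc] using h2⟩
  push Not at hHg
  have hfromH : ∀ R, G ≤ R → (∀ B : Finset V, b ≤ B.card → ∃ A ⊆ B, R.IsNClique s A) →
      (∃ K, R.IsCliquePacking (s + 1) K ∧ K.card = g - H.card ∧ ∀ C ∈ K, Disjoint C H) →
      ∃ K, R.IsCliquePacking (s + 1) K ∧ K.card = g := by
    rintro R hle hcl ⟨K, hK, hKc, hKH⟩
    obtain ⟨K', h1, h2, -⟩ := extend_packing hle hcl H ∅ (by simp) K hK (by simpa using hKH) (by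
      intro v hv
      have h1 := (mem_filter.1 hv).2
      have h2 := hsd v H
      rw [hKc, union_empty, Nat.sub_add_cancel hHg.le]
      nlinarith)
    exact ⟨K', h1, by omega⟩
  -- Removing H costs a vertex at most |H| neighbours, so the remaining degree keeps pace with the
  -- number of cliques still missing.
  have hdegH : ∀ v, g - H.card ≤ (nbrs G v \ H).card := by
    intro v
    have h1 := hG v
    have h2 := hsd v H
    omega
  by_cases hbig : 4 * b ≤ g - H.card
  · left
    intro R hle hcl
    refine hfromH R hle hcl ?_
    refine exists_packing_of_large_degree hle hcl H (Δ := Δ) (fun v _ => hdegH v) ?_ hbig ?_ ?_ hn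
    · intro v hv
      simpa [H] using hv
    · have : (g - H.card) * (s + 1) ≤ g * (s + 1) := Nat.mul_le_mul_right _ (by omega)
      nlinarith
    · nlinarith
  push Not at hbig
  -- With q = g - |H| < 4b, serving q vertices greedily takes degree q (s + 2) + b ≤ 5 (s + 2) b.
  set D := 8 * (s + 2) * b with hD
  have hq : (g - H.card) * (s + 2) ≤ 4 * b * (s + 2) := Nat.mul_le_mul_right _ hbig.le
  have hbD : b ≤ (s + 2) * b := Nat.le_mul_of_pos_left _ (by omega)
  set H2 := univ.filter fun v => v ∉ H ∧ D < (nbrs G v \ H).card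
  have hsd2 : ∀ (v : V) (A : Finset V),
      (nbrs G v \ H).card ≤ (nbrs G v \ (A ∪ H)).card + A.card := by
    intro v A
    refine (card_le_card (t := (nbrs G v \ (A ∪ H)) ∪ A) fun w hw => ?_).trans
      (card_union_le _ _)
    simp only [mem_union, mem_sdiff] at hw ⊢
    tauto
  have hH2H : Disjoint H2 H := disjoint_left.2 fun v hv => (mem_filter.1 hv).2.1
  by_cases hH2 : g - H.card ≤ H2.card
  · left
    intro R hle hcl
    refine hfromH R hle hcl ?_
    obtain ⟨A, hA, hAc⟩ := exists_subset_card_eq hH2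
    obtain ⟨K, h1, h2, h3⟩ := extend_packing hle hcl A H (hH2H.mono_left hA) ∅ (hempty R)
      (by simp) (by
        intro v hv
        have h1 := (mem_filter.1 (hA hv)).2.2
        have h2 := hsd2 v A
        rw [card_empty, zero_add, hAc]
        rw [hAc] at h2
        generalize g - H.card = q at *
        linarith)
    exact ⟨K, h1, by simpa [hAc] using h2, h3⟩
  push Not at hH2
  right
  have hcardHH : (H2 ∪ H).card ≤ H2.card + H.card := card_union_le _ _
  refine ⟨univ \ (H2 ∪ H), g - H.card - H2.card, ?_, by omega, by omega, ?_, ?_⟩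
  · rw [card_sdiff_of_subset (subset_univ _), card_univ]
    have : g ≤ 32 * (s + 2) ^ 2 * g := Nat.le_mul_of_pos_left _ (by positivity)
    have h2 : 2 * g ≤ n := by nlinarith
    change n ≤ 2 * (n - _)
    omega
  · intro v hv
    have hv' : v ∉ H2 ∧ v ∉ H := by simpa using hv
    have heq : nbrs G v ∩ (univ \ (H2 ∪ H)) = nbrs G v \ (H2 ∪ H) := by ext; simp
    rw [heq]
    have h1 := hdegH v
    have h2 := hsd2 v H2
    refine ⟨by omega, ?_⟩
    have h3 : (nbrs G v \ H).card ≤ D := by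
      by_contra h
      exact hv'.1 (mem_filter.2 ⟨mem_univ _, hv'.2, not_le.1 h⟩)
    exact (card_le_card (sdiff_subset_sdiff le_rfl subset_union_right)).trans h3
  · rintro R hle hcl ⟨K, hK, hKc, hKZ⟩
    refine hfromH R hle hcl ?_
    obtain ⟨K', h1, h2, h3⟩ := extend_packing hle hcl H2 H hH2H K hK (by
        intro C hC
        rw [disjoint_left]
        intro w hw
        exact (mem_sdiff.1 (hKZ C hC hw)).2) (by
        intro v hv
        have h1 := (mem_filter.1 hv).2.2
        have h2 := hsd2 v H2
        rw [hKc, Nat.sub_add_cancel hH2.le]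
        generalize g - H.card = q at *
        linarith)
    exact ⟨K', h1, by omega, h3⟩

end Greedy

end RandomSubset

/-! ### Random cliques in the moderate-degree set and in all large sets -/

namespace RandomSubset

variable {V : Type*} [Fintype V] [DecidableEq V]

set_option maxHeartbeats 1000000 in
/-- The random part of the argument: a set inducing a graph of moderate degrees. -/
lemma pr_not_packing_le {s u g a ρ : ℕ} {p c θ : ℝ} (hs : 2 ≤ s) (hp : 0 < p) (hp1 : p ≤ 1)
    (hu : 1 ≤ (u : ℝ) ^ 2 * p ^ s) (hun : 8 * s * u ≤ Fintype.card V) (hρ : 1 ≤ ρ)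
    (hρn : 48 * ρ ≤ Fintype.card V)
    (hθ : θ = (u : ℝ) ^ (s - 1) * p ^ ((s + 1).choose 2 - 1))
    (hθ1 : 192 * ρ ≤ Fintype.card V * θ) (hθ2 : Fintype.card V * θ ≤ c * ρ)
    {δ : ℝ} (hδ : δ = 2 ^ (s + 1) * c * ((ρ * a : ℕ) / u +
      8 * (s + 2) * ((ρ * a : ℕ) / Fintype.card V) + ρ * p)) (hδ1 : δ ≤ 1)
    {G : SimpleGraph V} {Z : Finset V} (hZ : Fintype.card V ≤ 2 * Z.card) (hg : 1 ≤ g)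
    (hgb : g ≤ 4 * (ρ * a))
    (hdeg : ∀ v ∈ Z, g ≤ (nbrs G v ∩ Z).card ∧ (nbrs G v ∩ Z).card ≤ 8 * (s + 2) * (ρ * a)) :
    pr (edgeProb V p) (fun S => ¬ ∃ K : Finset (Finset V),
      (G ⊔ SimpleGraph.fromEdgeSet (S : Set (Sym2 V))).IsCliquePacking (s + 1) K ∧ K.card = g ∧
        ∀ A ∈ K, A ⊆ Z) ≤ 8 / ((u : ℝ) ^ (s + 1) * p ^ (s + 1).choose 2) + 4 * δ := by
  have hu0 : 0 < u := by
    rcases Nat.eq_zero_or_pos u with rfl | h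
    · norm_num at hu
    · exact h
  have huR : (0 : ℝ) < u := by exact_mod_cast hu0
  have hρR : (0 : ℝ) < ρ := by exact_mod_cast hρ
  have hθ0 : 0 < θ := by rw [hθ]; positivity
  set n := Fintype.card V
  have hun1 : u ≤ n := le_trans (Nat.le_mul_of_pos_left u (by omega)) hun
  have hn : (0 : ℝ) < n := by exact_mod_cast hu0.trans_le hun1
  have hc0 : 0 < c := by
    have : 0 < c * ρ := lt_of_lt_of_le (by positivity) hθ2
    exact pos_of_mul_pos_left this hρR.le
  have hb0 : (0 : ℝ) ≤ (ρ * a : ℕ) := Nat.cast_nonneg _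
  have hunR : (u : ℝ) ≤ n := by exact_mod_cast hun1
  have hupθ : u * p * θ ≤ c * (ρ * p) := by
    calc u * p * θ ≤ n * p * θ := by gcongr
      _ = (n * θ) * p := by ring
      _ ≤ (c * ρ) * p := by gcongr
      _ = _ := by ring
  have hδup : 2 ^ (s + 1) * (u * p * θ) ≤ δ := by
    rw [hδ, mul_assoc ((2 : ℝ) ^ (s + 1)) c]
    refine mul_le_mul_of_nonneg_left (hupθ.trans (mul_le_mul_of_nonneg_left ?_ hc0.le))
      (by positivity)
    have : (0 : ℝ) ≤ (ρ * a : ℕ) / u + 8 * (s + 2) * ((ρ * a : ℕ) / n) := by positivity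
    linarith
  -- If few cliques are wanted, purely random ones suffice. Otherwise g exceeds a quarter of their
  -- mean, which at the end bounds 8 / (E.card * θ).
  by_cases hsmall : (g : ℝ) ≤ (u : ℝ) ^ (s + 1) * p ^ (s + 1).choose 2 / 4
  · obtain ⟨P, hP1, hP2, hP3⟩ := exists_disjoint_parts (U := Z) (r := s + 1) (u := u) (by
      have : (s + 1) * u ≤ 4 * s * u := Nat.mul_le_mul_right _ (by omega)
      have h2 : 8 * s * u = 2 * (4 * s * u) := by ring
      omega)
    refine (pr_not_packing_le_of_parts (by omega) hp hp1 hu hP1 hP2 hP3 ?_ hsmall G).trans ?_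
    · rw [← hθ]; exact hδup.trans hδ1
    · rw [← hθ]
      have : 4 * 2 ^ (s + 1) * (u * p * θ) ≤ 4 * δ := by linarith
      linarith
  push Not at hsmall
  obtain ⟨t, rfl⟩ : ∃ t, s = t + 1 := ⟨s - 1, by omega⟩
  -- X, Y and t = s - 1 parts of size u inside U make up the s + 1 parts.
  obtain ⟨X, Y, U, hX, hY, hU, hXY, hXU, hYU, hUc, hE0⟩ := exists_bipartite G (Z := Z) (g := g)
    (w := t * u) (fun v hv => (hdeg v hv).1) (by
      have h1 : 8 * (t + 1) * u = 2 * (4 * (t * u)) + 8 * u := by ring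
      omega)
  set d := 8 * (t + 1 + 2) * a
  have hD : 8 * (t + 1 + 2) * (ρ * a) = ρ * d := by ring
  obtain ⟨E', hE', hd1, hd2, hEc⟩ := exists_thinning (edgesBetween G X Y) (ρ := ρ) (d := d) (by
      intro v
      by_cases hv : v ∈ Z
      · rw [← hD]
        refine le_trans ?_ (hdeg v hv).2
        refine card_le_card_of_injOn Prod.snd ?_ ?_
        · intro e he
          have he := mem_filter.1 he
          rw [mem_edgesBetween] at he
          obtain ⟨⟨⟨-, h2⟩, h3⟩, rfl⟩ := he
          exact mem_inter.2 ⟨mem_nbrs.2 h3, hY h2⟩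
        · intro e he e' he' h
          exact Prod.ext ((mem_filter.1 he).2.trans (mem_filter.1 he').2.symm) h
      · rw [filter_eq_empty_iff.2]
        · simp
        · rintro e he rfl
          exact hv (hX (mem_edgesBetween.1 he).1.1)) (by
      intro v
      by_cases hv : v ∈ Z
      · rw [← hD]
        refine le_trans ?_ (hdeg v hv).2
        refine card_le_card_of_injOn Prod.fst ?_ ?_
        · intro e he
          have he := mem_filter.1 he
          rw [mem_edgesBetween] at he
          obtain ⟨⟨⟨h1, -⟩, h3⟩, rfl⟩ := he
          exact mem_inter.2 ⟨mem_nbrs.2 h3.symm, hX h1⟩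
        · intro e he e' he' h
          exact Prod.ext h ((mem_filter.1 he).2.trans (mem_filter.1 he').2.symm)
      · rw [filter_eq_empty_iff.2]
        · simp
        · rintro e he rfl
          exact hv (hY (mem_edgesBetween.1 he).1.2))
  -- n g ≤ 2 |Z| g ≤ 16 e(X, Y) ≤ 16 (2ρ + 1) |E'| ≤ 48 ρ |E'|.
  have hlow : (n : ℝ) * g / (48 * ρ) ≤ E'.card := by
    rw [div_le_iff₀ (by positivity)]
    have h1 : n * g ≤ 2 * Z.card * g := Nat.mul_le_mul_right _ hZ
    have h2 : (2 * ρ + 1) * E'.card ≤ 3 * ρ * E'.card := Nat.mul_le_mul_right _ (by omega)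
    have h3 : n * g ≤ E'.card * (48 * ρ) := by nlinarith
    exact_mod_cast h3
  set y : ℝ := (n : ℝ) * g / (48 * ρ) with hy
  have hgR : (1 : ℝ) ≤ g := by exact_mod_cast hg
  have hy1 : 1 ≤ y := by
    rw [hy, le_div_iff₀ (by positivity)]
    have : (48 * ρ : ℝ) ≤ n := by exact_mod_cast hρn
    nlinarith
  -- Just enough edges are kept: |E| θ ≥ 4g makes the mean large, while |E| θ ≤ c ρ a keeps overlaps
  -- small.
  obtain ⟨E, hE, hEm⟩ := exists_subset_card_eq (s := E') (n := ⌈y⌉₊) (Nat.ceil_le.2 hlow)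
  have hm1 : y ≤ E.card := by rw [hEm]; exact Nat.le_ceil y
  have hm2 : (E.card : ℝ) ≤ 2 * y := by
    rw [hEm]
    have := Nat.ceil_lt_add_one (show 0 ≤ y by linarith)
    linarith
  have hyθ1 : 4 * (g : ℝ) ≤ y * θ := by
    rw [hy, div_mul_eq_mul_div, le_div_iff₀ (by positivity)]
    have := mul_le_mul_of_nonneg_left hθ1 (zero_le_one.trans hgR)
    linarith
  have hyθ2 : y * θ ≤ c * g / 48 := by
    rw [hy, div_mul_eq_mul_div, div_le_div_iff₀ (by positivity) (by norm_num)]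
    have := mul_le_mul_of_nonneg_left hθ2 (zero_le_one.trans hgR)
    linarith
  have hμ1 : 4 * (g : ℝ) ≤ E.card * θ := hyθ1.trans (by gcongr)
  have hgbR : (g : ℝ) ≤ 4 * (ρ * a : ℕ) := by exact_mod_cast hgb
  have hμ2 : E.card * θ ≤ c * (ρ * a : ℕ) := by
    have h1 : E.card * θ ≤ 2 * y * θ := by gcongr
    have h2 := mul_le_mul_of_nonneg_left hgbR hc0.le
    have h3 := mul_nonneg hc0.le hb0
    linarith
  have hdθ : d * θ ≤ c * (8 * ((t + 1 : ℕ) + 2) * ((ρ * a : ℕ) / n)) := by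
    have h1 : θ ≤ c * ρ / n := by rw [le_div_iff₀ hn]; linarith
    calc d * θ ≤ d * (c * ρ / n) := by gcongr
      _ = _ := by simp only [d]; push_cast; ring
  obtain ⟨P, hP1, hP2, hP3⟩ := exists_disjoint_parts (U := U) (r := t) (u := u) hUc.ge
  set P' : Fin (t + 1 + 1) → Finset V := Fin.cons X (Fin.cons Y P)
  have hsum : 2 ^ (t + 1 + 1) * (E.card * θ / u + d * θ + u * p * θ) ≤ δ := by
    rw [hδ, mul_assoc ((2 : ℝ) ^ (t + 1 + 1)) c, mul_add c, mul_add c]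
    refine mul_le_mul_of_nonneg_left (add_le_add (add_le_add ?_ hdθ) hupθ) (by positivity)
    rw [mul_div_assoc']
    exact div_le_div_of_nonneg_right hμ2 huR.le
  have hθU : ∀ i, P' i ⊆ Z := by
    intro i
    refine Fin.cases ?_ (fun i => Fin.cases ?_ (fun i => ?_) i) i
    · exact hX
    · exact hY
    · exact (hP3 i).trans hU
  have hdisj : ∀ i j, i ≠ j → Disjoint (P' i) (P' j) := by
    intro i j
    refine Fin.cases ?_ (fun i => Fin.cases ?_ (fun i => ?_) i) i <;>
      refine Fin.cases ?_ (fun j => Fin.cases ?_ (fun j => ?_) j) j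
    · exact fun h => absurd rfl h
    · exact fun _ => hXY
    · exact fun _ => hXU.mono_right (hP3 j)
    · exact fun _ => hXY.symm
    · exact fun h => absurd rfl h
    · exact fun _ => hYU.mono_right (hP3 j)
    · exact fun _ => (hXU.mono_right (hP3 i)).symm
    · exact fun _ => (hYU.mono_right (hP3 i)).symm
    · exact fun h => hP1 i j fun hij => h (by rw [hij])
  have hcardP : ∀ i, i ≠ 0 → i ≠ 1 → (P' i).card = u := by
    intro i
    refine Fin.cases ?_ (fun i => Fin.cases ?_ (fun i => ?_) i) i
    · exact fun h => absurd rfl h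
    · exact fun _ h => absurd rfl h
    · exact fun _ _ => hP2 i
  have hEmem : ∀ e ∈ E, (e.1 ∈ X ∧ e.2 ∈ Y) ∧ G.Adj e.1 e.2 := fun e he =>
    mem_edgesBetween.1 (hE' (hE he))
  have hEne : E.Nonempty := by
    rw [← card_pos, hEm]
    exact Nat.ceil_pos.2 (by linarith)
  refine (pr_not_packing_le_of_edges (by omega) hp hp1 hu hdisj (a := 0) (b := 1)
    (by simp) hcardP hθU (E := E) (d := d) (fun e he => (hEmem e he).1)
    (fun e he => (hEmem e he).2)
    (fun v => (card_le_card (filter_subset_filter _ hE)).trans (hd1 v))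
    (fun v => (card_le_card (filter_subset_filter _ hE)).trans (hd2 v)) hEne hθ
    (hsum.trans hδ1) (by linarith)).trans ?_
  have hμs : 0 < (u : ℝ) ^ (t + 1 + 1) * p ^ (t + 1 + 1).choose 2 := by positivity
  have : 8 / (E.card * θ) ≤ 8 / ((u : ℝ) ^ (t + 1 + 1) * p ^ (t + 1 + 1).choose 2) :=
    div_le_div_of_nonneg_left (by norm_num) hμs (by linarith)
  linarith

/-- Unlikely that some set of size `b` contains no random `s`-clique. -/
lemma pr_not_forall_clique_le {s b : ℕ} {p : ℝ} (hs : 1 ≤ s) (hp : 0 < p) (hp1 : p ≤ 1)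
    (hδ : (2 : ℝ) ^ (2 * s + 2) * ((b / s : ℕ) ^ 2 * p ^ (s + 1)) ≤ 1)
    (hμ : 4 * (Fintype.card V : ℝ) ≤ ((b / s : ℕ) : ℝ) ^ s * p ^ s.choose 2) :
    pr (edgeProb V p) (fun S => ¬ ∀ B : Finset V, b ≤ B.card → ∃ A ⊆ B,
      (SimpleGraph.fromEdgeSet (S : Set (Sym2 V))).IsNClique s A) ≤
      Real.exp (-(Fintype.card V)) := by
  set I := (univ : Finset (Finset V)).filter fun B => b ≤ B.card
  have h1 : pr (edgeProb V p) (fun S => ¬ ∀ B : Finset V, b ≤ B.card → ∃ A ⊆ B,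
      (SimpleGraph.fromEdgeSet (S : Set (Sym2 V))).IsNClique s A) ≤
      pr (edgeProb V p) (fun S => ∃ B ∈ I, ¬ ∃ A ⊆ B,
        (SimpleGraph.fromEdgeSet (S : Set (Sym2 V))).IsNClique s A) := by
    refine pr_mono (edgeProb_nonneg hp.le) (edgeProb_le_one hp1) fun S hS => ?_
    obtain ⟨B, hB⟩ := not_forall.1 hS
    obtain ⟨hB, hBA⟩ := Classical.not_imp.1 hB
    exact ⟨B, mem_filter.2 ⟨mem_univ _, hB⟩, hBA⟩
  refine h1.trans ((pr_exists_le (edgeProb_nonneg hp.le) (edgeProb_le_one hp1) _ _).trans ?_)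
  -- A fixed set has mean at least 4n, hence fails with probability at most exp(-2n); there are at
  -- most 2^n ≤ exp n sets.
  have h2 : ∀ B ∈ I, pr (edgeProb V p) (fun S => ¬ ∃ A ⊆ B,
      (SimpleGraph.fromEdgeSet (S : Set (Sym2 V))).IsNClique s A) ≤
      Real.exp (-(2 * Fintype.card V)) := by
    intro B hB
    obtain ⟨P, hP1, hP2, hP3⟩ := exists_disjoint_parts (U := B) (r := s) (u := b / s)
      ((Nat.mul_div_le b s).trans (mem_filter.1 hB).2)
    refine (pr_not_clique_le hs hp hp1 hP1 hP2 hP3 hδ).trans (Real.exp_le_exp.2 ?_)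
    linarith
  refine (sum_le_sum h2).trans ?_
  rw [sum_const, nsmul_eq_mul]
  have h3 : (I.card : ℝ) ≤ 2 ^ Fintype.card V := by
    have := card_filter_le (univ : Finset (Finset V)) fun B => b ≤ B.card
    rw [card_univ, Fintype.card_finset] at this
    exact_mod_cast this
  have h4 : (2 : ℝ) ^ Fintype.card V ≤ Real.exp (Fintype.card V) := by
    rw [← mul_one (Fintype.card V : ℝ), Real.exp_nat_mul]
    gcongr
    linarith [Real.add_one_le_exp (1 : ℝ)]
  calc (I.card : ℝ) * Real.exp (-(2 * Fintype.card V))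
      ≤ Real.exp (Fintype.card V) * Real.exp (-(2 * Fintype.card V)) := by
        gcongr; exact h3.trans h4
    _ = _ := by rw [← Real.exp_add]; congr 1; ring

end RandomSubset

/-! ### Asymptotics of the edge probability -/

open Filter Topology

namespace RandomSubset

/-- The asymptotic properties of the edge probability `p`, with `a n * ρ n` the size of the sets
that have to contain a random clique. -/
structure RegularProb (s : ℕ) (c : ℝ) (p : ℕ → ℝ) (a ρ : ℕ → ℕ) : Prop where
  pos : ∀ᶠ n : ℕ in atTop, 0 < p n
  tendsto_p : Tendsto p atTop (𝓝 0)
  tendsto_mul : Tendsto (fun n : ℕ => n * p n) atTop atTop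
  tendsto_pow : Tendsto (fun n : ℕ => (n : ℝ) ^ 2 * p n ^ s) atTop atTop
  tendsto_pow_succ : Tendsto (fun n : ℕ => (n : ℝ) ^ 2 * p n ^ (s + 1)) atTop (𝓝 0)
  one_le : ∀ᶠ n : ℕ in atTop, 1 ≤ ρ n
  lower : ∀ᶠ n : ℕ in atTop, c * ρ n / 2 ≤ (n : ℝ) ^ s * p n ^ ((s + 1).choose 2 - 1)
  upper : ∀ᶠ n : ℕ in atTop, (n : ℝ) ^ s * p n ^ ((s + 1).choose 2 - 1) ≤ c * ρ n
  tendsto_size : Tendsto (fun n : ℕ => ((ρ n * a n : ℕ) : ℝ) / n) atTop (𝓝 0)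
  tendsto_factor : Tendsto (fun n : ℕ => ρ n * p n) atTop (𝓝 0)
  clique : ∀ᶠ n : ℕ in atTop,
    4 * (n : ℝ) ≤ ((ρ n * a n / s : ℕ) : ℝ) ^ s * p n ^ s.choose 2

lemma choose_succ_two_sub_one (s : ℕ) (hs : 1 ≤ s) :
    (((s + 1).choose 2 - 1 : ℕ) : ℝ) = ((s : ℝ) - 1) * (s + 2) / 2 := by
  have h : 1 ≤ (s + 1).choose 2 := Nat.choose_pos (by omega)
  rw [Nat.cast_sub h, Nat.cast_choose_two]
  push_cast; ring

/-- This identity explains φ: for p = C n^(-φ) it makes n^s p^M, with M = C(s+1,2) - 1, independent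
of n. -/
lemma phiExp_mul_choose (s : ℕ) (hs : 2 ≤ s) :
    phiExp s * (((s + 1).choose 2 - 1 : ℕ) : ℝ) = s := by
  have : (2 : ℝ) ≤ s := by exact_mod_cast hs
  rw [choose_succ_two_sub_one s (by omega), phiExp]
  have h1 : (s : ℝ) - 1 ≠ 0 := by linarith
  field_simp

/-- The factor 2 absorbs the rounding in `m / s`. -/
lemma natFloor_ge {b x : ℝ} {m s : ℕ} (hs : 1 ≤ s) (hb : b ≤ m) (hx : x = b / (2 * s))
    (h1 : 2 * s ≤ b) : x ≤ ((m / s : ℕ) : ℝ) := by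
  have hsR : (0 : ℝ) < s := by exact_mod_cast hs
  have h2 : (m : ℝ) / s - 1 ≤ ((m / s : ℕ) : ℝ) := by
    rw [← Nat.floor_div_eq_div (K := ℝ)]
    linarith [Nat.lt_floor_add_one ((m : ℝ) / s)]
  have h3 : b / s ≤ m / s := by gcongr
  have h4 : x = b / s / 2 := by rw [hx]; field_simp
  have h5 : 2 ≤ b / s := by rw [le_div_iff₀ hsR]; exact h1
  linarith

/-- Since n^s p^M is constant, ρ = 1 will do. For sets of size n the mean number of s-cliques has
exponent 1 + (s-2)/(s+2); passing to size n^(1-e) gives up half of the surplus over 1, which is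
positive only because s ≥ 3. -/
lemma regularProb_of_three_le {s : ℕ} (hs : 3 ≤ s) {C : ℝ} (hC : 1 ≤ C) :
    ∃ a ρ : ℕ → ℕ, RegularProb s (C ^ ((s + 1).choose 2 - 1))
      (fun n => C * thresholdProb s n) a ρ := by
  have hsR : (3 : ℝ) ≤ s := by exact_mod_cast hs
  have hC0 : 0 < C := by linarith
  set e : ℝ := ((s : ℝ) - 2) / (2 * s * (s + 2)) with he
  set φ := phiExp s with hφ
  have hp : (fun n : ℕ => C * thresholdProb s n) = fun n : ℕ => C * (n : ℝ) ^ (-φ) := by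
    ext n; rw [thresholdProb, if_neg (by omega)]
  have hden : 0 < ((s : ℝ) - 1) * (s + 2) := mul_pos (by linarith) (by linarith)
  have hφ0 : 0 < φ := by rw [hφ, phiExp]; exact div_pos (by linarith) hden
  have hφ1 : φ < 1 := by rw [hφ, phiExp, div_lt_one hden]; nlinarith
  have hφs : φ * s < 2 := by
    rw [hφ, phiExp, div_mul_eq_mul_div, div_lt_iff₀ hden]; nlinarith
  have hφs1 : 2 < φ * (s + 1) := by
    rw [hφ, phiExp, div_mul_eq_mul_div, lt_div_iff₀ hden]; nlinarith
  have he0 : 0 < e := div_pos (by linarith) (by positivity)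
  have he1 : e < 1 := by
    rw [he, div_lt_one (by positivity)]; nlinarith
  have hpow : ∀ n : ℕ, 0 < n → ∀ i j : ℕ, (n : ℝ) ^ i * (C * (n : ℝ) ^ (-φ)) ^ j =
      C ^ j * (n : ℝ) ^ (i - φ * j) := by
    intro n hn i j
    have hn : (0 : ℝ) < n := by exact_mod_cast hn
    rw [mul_pow, ← Real.rpow_mul_natCast hn.le, sub_eq_add_neg, Real.rpow_add hn,
      Real.rpow_natCast]
    ring_nf
  have hzero : ∀ y : ℝ, 0 < y → Tendsto (fun n : ℕ => (n : ℝ) ^ (-y)) atTop (𝓝 0) :=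
    fun y hy => (tendsto_rpow_neg_atTop hy).comp tendsto_natCast_atTop_atTop
  have htop : ∀ y : ℝ, 0 < y → Tendsto (fun n : ℕ => (n : ℝ) ^ y) atTop atTop :=
    fun y hy => (tendsto_rpow_atTop hy).comp tendsto_natCast_atTop_atTop
  have hpt : Tendsto (fun n : ℕ => C * (n : ℝ) ^ (-φ)) atTop (𝓝 0) := by
    simpa using (hzero φ hφ0).const_mul C
  refine ⟨fun n => ⌈(n : ℝ) ^ (1 - e)⌉₊, fun _ => 1, ?_⟩
  rw [hp]
  refine ⟨?_, hpt, ?_, ?_, ?_, by simp, ?_, ?_, ?_, ?_, ?_⟩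
  · filter_upwards [eventually_gt_atTop 0] with n hn
    have : (0 : ℝ) < n := by exact_mod_cast hn
    positivity
  · have h := (htop (1 - φ) (by linarith)).const_mul_atTop hC0
    refine h.congr' ?_
    filter_upwards [eventually_gt_atTop 0] with n hn
    have := hpow n hn 1 1
    simp only [pow_one, Nat.cast_one, mul_one] at this
    exact this.symm
  · have h := (htop (2 - φ * s) (by linarith)).const_mul_atTop (pow_pos hC0 s)
    refine h.congr' ?_
    filter_upwards [eventually_gt_atTop 0] with n hn
    rw [hpow n hn]; push_cast; rfl
  · have h := (hzero (φ * (s + 1) - 2) (by linarith)).const_mul (C ^ (s + 1))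
    rw [mul_zero] at h
    refine h.congr' ?_
    filter_upwards [eventually_gt_atTop 0] with n hn
    rw [hpow n hn]; push_cast; ring_nf
  · filter_upwards [eventually_gt_atTop 0] with n hn
    rw [hpow n hn, phiExp_mul_choose s (by omega), sub_self, Real.rpow_zero]
    have : 0 ≤ C ^ ((s + 1).choose 2 - 1) := by positivity
    push_cast; linarith
  · filter_upwards [eventually_gt_atTop 0] with n hn
    rw [hpow n hn, phiExp_mul_choose s (by omega), sub_self, Real.rpow_zero]
    push_cast; linarith
  · have h := (hzero e he0).add tendsto_inv_atTop_nhds_zero_nat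
    rw [add_zero] at h
    refine squeeze_zero' (Eventually.of_forall fun n => by positivity) ?_ h
    filter_upwards [eventually_gt_atTop 0] with n hn
    have hn : (0 : ℝ) < n := by exact_mod_cast hn
    rw [one_mul, div_le_iff₀ hn, add_mul, inv_mul_cancel₀ hn.ne']
    have h1 := Nat.ceil_lt_add_one (show 0 ≤ (n : ℝ) ^ (1 - e) by positivity)
    have h2 : (n : ℝ) ^ (-e) * n = (n : ℝ) ^ (1 - e) := by
      rw [sub_eq_add_neg, add_comm, Real.rpow_add hn, Real.rpow_one]
    linarith
  · simpa using hpt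
  · have hexp : 0 < ((s : ℝ) - 2) / (2 * (s + 2)) := div_pos (by linarith) (by linarith)
    filter_upwards [eventually_gt_atTop 0,
      (htop (1 - e) (by linarith)).eventually_ge_atTop (2 * s),
      (htop _ hexp).eventually_ge_atTop (4 * (2 * s) ^ s)] with n hn h1 h2
    have hq := natFloor_ge (s := s) (by omega) (Nat.le_ceil ((n : ℝ) ^ (1 - e))) rfl h1
    have hn' : (0 : ℝ) < n := by exact_mod_cast hn
    rw [one_mul]
    have hsc : ((s.choose 2 : ℕ) : ℝ) = s * (s - 1) / 2 := Nat.cast_choose_two ℝ s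
    have hφe : φ * ((s.choose 2 : ℕ) : ℝ) = (s : ℝ) ^ 2 / (s + 2) := by
      rw [hsc, hφ, phiExp]
      have h1 : (s : ℝ) - 1 ≠ 0 := by linarith
      field_simp
    calc 4 * (n : ℝ) ≤ (n : ℝ) ^ (((s : ℝ) - 2) / (2 * (s + 2))) / (2 * s) ^ s * n := by
          gcongr
          rw [le_div_iff₀ (by positivity)]
          exact h2
      _ = ((n : ℝ) ^ (1 - e) / (2 * s)) ^ s * ((n : ℝ) ^ (-φ)) ^ s.choose 2 := by
          rw [div_pow, ← Real.rpow_mul_natCast hn'.le, ← Real.rpow_mul_natCast hn'.le,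
            div_mul_eq_mul_div, div_mul_eq_mul_div, ← Real.rpow_add hn', neg_mul, hφe]
          congr 1
          nth_rw 2 [← Real.rpow_one (n : ℝ)]
          rw [← Real.rpow_add hn']
          congr 1
          rw [he]
          field_simp
          ring
      _ ≤ _ := by
          gcongr
          exact le_mul_of_one_le_left (by positivity) hC

/-- Here n² p² = C² log² n, whence ρ ≈ log² n. The set size b ≈ n / (log n)^(1/4) is o(n), yet b² p
≈ C n √(log n) exceeds any multiple of n. -/
lemma regularProb_two {C : ℝ} (hC : 1 ≤ C) :
    ∃ a ρ : ℕ → ℕ, RegularProb 2 (C ^ ((2 + 1).choose 2 - 1))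
      (fun n => C * thresholdProb 2 n) a ρ := by
  have hC0 : 0 < C := by linarith
  set L : ℕ → ℝ := fun n => Real.log n with hL
  have hp : (fun n : ℕ => C * thresholdProb 2 n) = fun n : ℕ => C * (L n / n) := by
    ext n; simp [thresholdProb, hL]
  have hLt : Tendsto L atTop atTop := Real.tendsto_log_atTop.comp tendsto_natCast_atTop_atTop
  have hlog : ∀ k : ℕ, Tendsto (fun n : ℕ => L n ^ k / n) atTop (𝓝 0) := fun k =>
    (Real.isLittleO_pow_log_id_atTop (n := k)).tendsto_div_nhds_zero.comp
      tendsto_natCast_atTop_atTop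
  have hr : Tendsto (fun n => √√(L n)) atTop atTop :=
    Real.tendsto_sqrt_atTop.comp (Real.tendsto_sqrt_atTop.comp hLt)
  have hρ2 : ∀ n, 1 ≤ L n → (⌈L n ^ 2⌉₊ : ℝ) ≤ 2 * L n ^ 2 := by
    intro n hn
    have := Nat.ceil_lt_add_one (show 0 ≤ L n ^ 2 by positivity)
    nlinarith
  have hc2 : (2 + 1).choose 2 - 1 = 2 := rfl
  -- The size is an exact multiple of ρ, so that thinning by ρ leaves an integral degree bound.
  refine ⟨fun n => ⌈n / (⌈L n ^ 2⌉₊ * √√(L n))⌉₊, fun n => ⌈L n ^ 2⌉₊, ?_⟩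
  rw [hp, hc2]
  have hev : ∀ᶠ n : ℕ in atTop, 0 < n ∧ 1 ≤ L n :=
    (eventually_gt_atTop 0).and (hLt.eventually_ge_atTop 1)
  refine ⟨?_, ?_, ?_, ?_, ?_, ?_, ?_, ?_, ?_, ?_, ?_⟩
  · filter_upwards [hev] with n hn
    have h1 : (0 : ℝ) < n := by exact_mod_cast hn.1
    have h2 : 0 < L n := by linarith [hn.2]
    positivity
  · simpa using (hlog 1).const_mul C
  · refine (hLt.const_mul_atTop hC0).congr' ?_
    filter_upwards [hev] with n hn
    have h1 : (0 : ℝ) < n := by exact_mod_cast hn.1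
    field_simp
  · have := ((tendsto_pow_atTop two_ne_zero).comp hLt).const_mul_atTop (pow_pos hC0 2)
    refine this.congr' ?_
    filter_upwards [hev] with n hn
    have h1 : (0 : ℝ) < n := by exact_mod_cast hn.1
    simp only [Function.comp]
    field_simp
  · have := (hlog 3).const_mul (C ^ 3)
    rw [mul_zero] at this
    refine this.congr' ?_
    filter_upwards [hev] with n hn
    have h1 : (0 : ℝ) < n := by exact_mod_cast hn.1
    simp only [Nat.reduceAdd]
    field_simp
  · filter_upwards [hev] with n hn
    exact Nat.ceil_pos.2 (by nlinarith [hn.2])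
  · filter_upwards [hev] with n hn
    have h1 : (0 : ℝ) < n := by exact_mod_cast hn.1
    have h2 : (n : ℝ) ^ 2 * (C * (L n / n)) ^ 2 = C ^ 2 * L n ^ 2 := by field_simp
    rw [hc2, h2, mul_div_assoc]
    gcongr
    linarith [hρ2 n hn.2]
  · filter_upwards [hev] with n hn
    have h1 : (0 : ℝ) < n := by exact_mod_cast hn.1
    have h2 : (n : ℝ) ^ 2 * (C * (L n / n)) ^ 2 = C ^ 2 * L n ^ 2 := by field_simp
    rw [hc2, h2]
    gcongr
    exact Nat.le_ceil _
  · have h := (tendsto_inv_atTop_zero.comp hr).add ((hlog 2).const_mul 2)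
    rw [mul_zero, add_zero] at h
    refine squeeze_zero' (Eventually.of_forall fun n => by positivity) ?_ h
    filter_upwards [hev] with n hn
    have h1 : (0 : ℝ) < n := by exact_mod_cast hn.1
    have h2 : 0 < L n := by linarith [hn.2]
    have h3 := hρ2 n hn.2
    have h4 : (0 : ℝ) < ⌈L n ^ 2⌉₊ := by exact_mod_cast Nat.ceil_pos.2 (by positivity)
    have h5 : 0 < √√(L n) := by positivity
    have h6 := Nat.ceil_lt_add_one
      (show 0 ≤ (n : ℝ) / (⌈L n ^ 2⌉₊ * √√(L n)) by positivity)
    simp only [Function.comp]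
    push_cast
    rw [div_le_iff₀ h1]
    calc (⌈L n ^ 2⌉₊ : ℝ) * ⌈(n : ℝ) / (⌈L n ^ 2⌉₊ * √√(L n))⌉₊
        ≤ ⌈L n ^ 2⌉₊ * ((n : ℝ) / (⌈L n ^ 2⌉₊ * √√(L n)) + 1) := by gcongr
      _ = n / √√(L n) + ⌈L n ^ 2⌉₊ := by field_simp
      _ ≤ n / √√(L n) + 2 * L n ^ 2 := by linarith
      _ = _ := by field_simp
  · have h := (hlog 3).const_mul (2 * C)
    rw [mul_zero] at h
    refine squeeze_zero' ?_ ?_ h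
    · filter_upwards [hev] with n hn
      have h2 : 0 < L n := by linarith [hn.2]
      positivity
    · filter_upwards [hev] with n hn
      have h2 : 0 < L n := by linarith [hn.2]
      calc (⌈L n ^ 2⌉₊ : ℝ) * (C * (L n / n)) ≤ (2 * L n ^ 2) * (C * (L n / n)) := by
            gcongr; exact hρ2 n hn.2
        _ = _ := by ring
  -- With r = (log n)^(1/4), r ≥ 8 makes n r² / 16 at least 4n.
  · filter_upwards [hev, hr.eventually_ge_atTop 8,
      (hlog 1).eventually (gt_mem_nhds (show (0 : ℝ) < 1 / 4 by norm_num))] with n hn hr8 hl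
    have h1 : (0 : ℝ) < n := by exact_mod_cast hn.1
    have h2 : 0 < L n := by linarith [hn.2]
    have h4 : (0 : ℝ) < ⌈L n ^ 2⌉₊ := by exact_mod_cast Nat.ceil_pos.2 (by positivity)
    have h5 : 0 < √√(L n) := by positivity
    set r := √√(L n)
    have hr4 : L n = r ^ 4 := by
      rw [show r ^ 4 = (r ^ 2) ^ 2 by ring, Real.sq_sqrt (Real.sqrt_nonneg _),
        Real.sq_sqrt h2.le]
    have hb : (n : ℝ) / r ≤ ((⌈L n ^ 2⌉₊ * ⌈(n : ℝ) / (⌈L n ^ 2⌉₊ * r)⌉₊ : ℕ) : ℝ) := by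
      push_cast
      calc (n : ℝ) / r = ⌈L n ^ 2⌉₊ * ((n : ℝ) / (⌈L n ^ 2⌉₊ * r)) := by field_simp
        _ ≤ _ := by gcongr; exact Nat.le_ceil _
    have hge : 2 * ((2 : ℕ) : ℝ) ≤ n / r := by
      rw [le_div_iff₀ h5]
      rw [pow_one, div_lt_iff₀ h1, hr4] at hl
      have : r ≤ r ^ 4 := le_self_pow₀ (by linarith) (by norm_num)
      push_cast; linarith
    have hq := natFloor_ge (s := 2) (by norm_num) hb rfl hge
    rw [show Nat.choose 2 2 = 1 from rfl, pow_one]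
    calc 4 * (n : ℝ) ≤ n * r ^ 2 / 16 := by
          have h6 : 64 ≤ r ^ 2 := by nlinarith
          linarith [mul_le_mul_of_nonneg_left h6 h1.le]
      _ = ((n : ℝ) / r / (2 * (2 : ℕ))) ^ 2 * (1 * (L n / n)) := by
        rw [hr4]; push_cast; field_simp; norm_num
      _ ≤ _ := by gcongr

lemma exists_regularProb {s : ℕ} (hs : 2 ≤ s) {C : ℝ} (hC : 1 ≤ C) :
    ∃ a ρ : ℕ → ℕ, RegularProb s (C ^ ((s + 1).choose 2 - 1))
      (fun n => C * thresholdProb s n) a ρ := by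
  rcases Nat.lt_or_ge 2 s with h | h
  · exact regularProb_of_three_le h hC
  · obtain rfl : s = 2 := by omega
    exact regularProb_two hC

end RandomSubset

/-! ### All estimates hold for large n -/

namespace RandomSubset

lemma eventually_div_bounds {s : ℕ} (hs : 1 ≤ s) :
    ∀ᶠ n : ℕ in atTop, (n : ℝ) / (16 * s) ≤ (n / (8 * s) : ℕ) := by
  filter_upwards [eventually_ge_atTop (16 * s)] with n hn
  have h1 := Nat.lt_mul_div_succ n (show 0 < 8 * s by omega)
  have h2 : 1 ≤ n / (8 * s) := (Nat.one_le_div_iff (by omega)).2 (by omega)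
  have hsR : (0 : ℝ) < s := by exact_mod_cast hs
  rw [div_le_iff₀ (by positivity)]
  have h3 : 8 * s * (n / (8 * s) + 1) ≤ 8 * s * (n / (8 * s) + n / (8 * s)) :=
    Nat.mul_le_mul_left _ (by omega)
  have h4 : n ≤ n / (8 * s) * (16 * s) := by nlinarith
  exact_mod_cast h4

/-- All the quantities of the probabilistic estimates are eventually in range. -/
lemma RegularProb.eventually_estimates {s : ℕ} {c : ℝ} {p : ℕ → ℝ} {a ρ : ℕ → ℕ} (hs : 2 ≤ s)
    (hc : 384 * (16 * s) ^ s ≤ c) (h : RegularProb s c p a ρ) {ε : ℝ} (hε : 0 < ε) :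
    ∀ᶠ n : ℕ in atTop, ∃ θ δ : ℝ, (0 < p n ∧ p n ≤ 1) ∧
      1 ≤ ((n / (8 * s) : ℕ) : ℝ) ^ 2 * p n ^ s ∧ 1 ≤ ρ n ∧ 48 * ρ n ≤ n ∧
      θ = ((n / (8 * s) : ℕ) : ℝ) ^ (s - 1) * p n ^ ((s + 1).choose 2 - 1) ∧
      192 * ρ n ≤ n * θ ∧ n * θ ≤ c * ρ n ∧
      δ = 2 ^ (s + 1) * c * ((ρ n * a n : ℕ) / ((n / (8 * s) : ℕ) : ℝ) +
        8 * (s + 2) * ((ρ n * a n : ℕ) / n) + ρ n * p n) ∧ δ ≤ 1 ∧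
      8 / (((n / (8 * s) : ℕ) : ℝ) ^ (s + 1) * p n ^ (s + 1).choose 2) + 4 * δ ≤ ε := by
  have hsR : (2 : ℝ) ≤ s := by exact_mod_cast hs
  have hc0 : 0 < c := lt_of_lt_of_le (by positivity) hc
  -- An upper bound for δ, with u replaced by n / (16 s); its terms tend to 0.
  set δb : ℕ → ℝ := fun n => 2 ^ (s + 1) * c * (16 * s * ((ρ n * a n : ℕ) / n : ℝ) +
        8 * (s + 2) * ((ρ n * a n : ℕ) / n : ℝ) + ρ n * p n)
  have hδb : Tendsto δb atTop (𝓝 0) := by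
    have := (((h.tendsto_size.const_mul (16 * (s : ℝ))).add
      (h.tendsto_size.const_mul (8 * ((s : ℝ) + 2)))).add h.tendsto_factor).const_mul
        (2 ^ (s + 1) * c)
    simpa [δb] using this
  filter_upwards [h.pos, h.tendsto_p.eventually (gt_mem_nhds one_pos), h.one_le, h.lower, h.upper,
    eventually_div_bounds (show 1 ≤ s by omega),
    h.tendsto_pow.eventually_ge_atTop ((16 * s) ^ 2),
    h.tendsto_mul.eventually_ge_atTop 1,
    h.tendsto_mul.eventually_ge_atTop (16 * s * (16 * s / ε)),
    h.tendsto_factor.eventually (gt_mem_nhds (show (0 : ℝ) < 1 / 48 by norm_num)),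
    hδb.eventually (gt_mem_nhds one_pos),
    hδb.eventually (gt_mem_nhds (show 0 < ε / 8 by positivity)),
    eventually_gt_atTop 0] with n hp hp1 hρ hlow hup hu hpow hnp hnpε hρp hδ1 hδε hn
  set u := n / (8 * s)
  have hnR : (0 : ℝ) < n := by exact_mod_cast hn
  have hρR : (1 : ℝ) ≤ ρ n := by exact_mod_cast hρ
  have huR : (0 : ℝ) < u := lt_of_lt_of_le (by positivity) hu
  have hun : (u : ℝ) ≤ n := by exact_mod_cast Nat.div_le_self _ _
  have h16 : (0 : ℝ) < 16 * s := by positivity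
  have hnu : (n : ℝ) ≤ 16 * s * u := by
    rw [div_le_iff₀ h16] at hu; linarith
  set θ := (u : ℝ) ^ (s - 1) * p n ^ ((s + 1).choose 2 - 1) with hθ
  set δ := 2 ^ (s + 1) * c * ((ρ n * a n : ℕ) / (u : ℝ) +
        8 * (s + 2) * ((ρ n * a n : ℕ) / n) + ρ n * p n) with hδ
  have hs1 : s = s - 1 + 1 := by omega
  have hθ0 : 0 < θ := by positivity
  have hnθ : (n : ℝ) ^ s * p n ^ ((s + 1).choose 2 - 1) ≤ (16 * s) ^ (s - 1) * (n * θ) := by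
    calc (n : ℝ) ^ s * p n ^ ((s + 1).choose 2 - 1)
        = n ^ (s - 1) * n * p n ^ ((s + 1).choose 2 - 1) := by rw [← pow_succ, ← hs1]
      _ ≤ (16 * s * u) ^ (s - 1) * n * p n ^ ((s + 1).choose 2 - 1) := by gcongr
      _ = _ := by rw [hθ, mul_pow]; ring
  -- Passing from n to u costs (16 s)^(s-1) and `lower` a factor 2, whence the requirement c ≥ 384
  -- (16 s)^s.
  have hlow' : 192 * ρ n ≤ n * θ := by
    have h1 : (0 : ℝ) < (16 * s) ^ (s - 1) := by positivity
    have h2 : (16 * (s : ℝ)) ^ (s - 1) ≤ (16 * s) ^ s :=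
      pow_le_pow_right₀ (by linarith) (by omega)
    have h3 : (16 * (s : ℝ)) ^ (s - 1) * (192 * ρ n) ≤ (16 * s) ^ (s - 1) * (n * θ) := by
      refine le_trans ?_ (hlow.trans hnθ)
      calc (16 * (s : ℝ)) ^ (s - 1) * (192 * ρ n) ≤ (16 * s) ^ s * (192 * ρ n) := by gcongr
        _ = 384 * (16 * s) ^ s * ρ n / 2 := by ring
        _ ≤ _ := by gcongr
    exact le_of_mul_le_mul_left h3 h1
  have hup' : n * θ ≤ c * ρ n := by
    refine le_trans ?_ hup
    calc (n : ℝ) * θ ≤ n * ((n : ℝ) ^ (s - 1) * p n ^ ((s + 1).choose 2 - 1)) := by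
          rw [hθ]; gcongr
      _ = (n ^ (s - 1) * n) * p n ^ ((s + 1).choose 2 - 1) := by ring
      _ = _ := by rw [← pow_succ, ← hs1]
  have hδδ : δ ≤ δb n := by
    simp only [hδ, δb]
    gcongr
    rw [mul_div_assoc', div_le_div_iff₀ huR hnR]
    have : (0 : ℝ) ≤ (ρ n * a n : ℕ) := Nat.cast_nonneg _
    calc ((ρ n * a n : ℕ) : ℝ) * n ≤ (ρ n * a n : ℕ) * (16 * s * u) := by gcongr
      _ = _ := by ring
  refine ⟨θ, δ, ⟨hp, hp1.le⟩, ?_, hρ, ?_, rfl, hlow', hup', rfl, hδδ.trans hδ1.le, ?_⟩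
  · have h1 : (16 * (s : ℝ)) ^ 2 * 1 ≤ (16 * s) ^ 2 * ((u : ℝ) ^ 2 * p n ^ s) := by
      calc (16 * (s : ℝ)) ^ 2 * 1 ≤ (n : ℝ) ^ 2 * p n ^ s := by rw [mul_one]; exact hpow
        _ ≤ (16 * s * u) ^ 2 * p n ^ s := by gcongr
        _ = _ := by ring
    exact le_of_mul_le_mul_left h1 (by positivity)
  -- n p ≥ 1 turns ρ p < 1/48 into 48 ρ ≤ n.
  · have h1 : (ρ n : ℝ) * 1 ≤ ρ n * (n * p n) := by gcongr
    have h2 : (n : ℝ) * (ρ n * p n) ≤ n * (1 / 48) := by gcongr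
    have h3 : (48 * ρ n : ℝ) ≤ n := by nlinarith
    exact_mod_cast h3
  -- The mean is (u p)(u θ) with u p ≥ 16 s / ε and u θ ≥ 12 / s, so it is at least 192 / ε.
  · have hch : (s + 1).choose 2 = (s + 1).choose 2 - 1 + 1 := by
      have : 1 ≤ (s + 1).choose 2 := Nat.choose_pos (by omega)
      omega
    have hμ : (u : ℝ) ^ (s + 1) * p n ^ (s + 1).choose 2 = u * p n * (u * θ) := by
      rw [hθ, hch, pow_succ (p n), show s + 1 = s - 1 + 1 + 1 by omega, pow_succ, pow_succ,
        Nat.add_sub_cancel]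
      rw [← hs1]
      ring
    have h1 : 192 ≤ 16 * s * (u * θ) := by
      calc (192 : ℝ) ≤ 192 * ρ n := by linarith
        _ ≤ n * θ := hlow'
        _ ≤ 16 * s * u * θ := by gcongr
        _ = _ := by ring
    have h2 : 16 * s * (16 * s / ε) ≤ 16 * s * (u * p n) := by
      calc _ ≤ n * p n := hnpε
        _ ≤ 16 * s * u * p n := by gcongr
        _ = _ := by ring
    have h3 : 16 * s / ε ≤ u * p n := le_of_mul_le_mul_left h2 h16
    have h4 : 192 / ε ≤ u * p n * (u * θ) := by
      calc 192 / ε ≤ 16 * s * (u * θ) / ε := by gcongr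
        _ = 16 * s / ε * (u * θ) := by ring
        _ ≤ _ := by gcongr
    have h5 : 8 / (u * p n * (u * θ)) ≤ ε / 24 := by
      rw [div_le_iff₀ (by positivity)]
      calc (8 : ℝ) = ε / 24 * (192 / ε) := by field_simp; norm_num
        _ ≤ _ := by gcongr
    rw [hμ]
    linarith

lemma hasDisjointCliques_of_packing {V : Type*} {H : SimpleGraph V} {k g : ℕ}
    {K : Finset (Finset V)} (hK : H.IsCliquePacking k K) (hg : K.card = g) :
    HasDisjointCliques H k g := by
  refine ⟨fun i => ((K.equivFinOfCardEq hg).symm i : Finset V), fun i => hK.1 _ (by simp),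
    fun i j hij => hK.2 _ (by simp) _ (by simp) fun h => hij ?_⟩
  exact (K.equivFinOfCardEq hg).symm.injective (Subtype.ext h)

end RandomSubset

end

/-! ### Assembly of the theorem -/

open Finset Filter Topology RandomSubset in
theorem lemma4p3 (s : ℕ) (hs : 2 ≤ s) :
    ∃ β C : ℝ, 0 < β ∧ 0 < C ∧
      ∀ ε : ℝ, 0 < ε → ∃ N : ℕ, ∀ n : ℕ, N ≤ n →
        ∀ (G : SimpleGraph (Fin n)) [DecidableRel G.Adj] (g : ℕ),
          G.minDegree = g → (g : ℝ) ≤ β * (n : ℝ) →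
            1 - ε ≤ (SimpleGraph.binomialRandom (Fin n) (truncProb (C * thresholdProb s n))).real
              {R : SimpleGraph (Fin n) | HasDisjointCliques (G ⊔ R) (s + 1) g} := by
  have hsR : (2 : ℝ) ≤ s := by exact_mod_cast hs
  -- The constant required of c = C^M; it passes to C^M because C ≥ 1 and M ≥ 1.
  set C : ℝ := 384 * (16 * s) ^ s with hC
  have hC1 : 1 ≤ C := by
    have : (1 : ℝ) ≤ (16 * s) ^ s := one_le_pow₀ (by linarith)
    linarith
  obtain ⟨a, ρ, h⟩ := exists_regularProb hs hC1
  have hM : (s + 1).choose 2 - 1 ≠ 0 := by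
    have := choose_succ_two s
    omega
  have hcC : C ≤ C ^ ((s + 1).choose 2 - 1) := le_self_pow₀ hC1 hM
  refine ⟨1 / (32 * (s + 2) ^ 2), C, by positivity, by positivity, fun ε hε => ?_⟩
  rw [← eventually_atTop]
  have hexp : Tendsto (fun n : ℕ => Real.exp (-(n : ℝ))) atTop (𝓝 0) :=
    Real.tendsto_exp_neg_atTop_nhds_zero.comp tendsto_natCast_atTop_atTop
  -- These facts do not involve G, which is introduced only afterwards; hence the uniformity.
  filter_upwards [h.eventually_estimates hs hcC (half_pos hε), h.clique,
    h.tendsto_pow_succ.eventually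
      (gt_mem_nhds (show (0 : ℝ) < 1 / 2 ^ (2 * s + 2) by positivity)),
    hexp.eventually (gt_mem_nhds (half_pos hε)),
    h.tendsto_size.eventually
      (gt_mem_nhds (show (0 : ℝ) < 1 / (32 * (s + 2) ^ 2) by positivity)),
    eventually_gt_atTop 0] with n hest hclique hpow hexpn hsize hn G _ g hG hg
  obtain ⟨θ, δ, ⟨hp, hp1⟩, hu, hρ, hρn, hθ, hθ1, hθ2, hδ, hδ1, herr⟩ := hest
  set p := C * thresholdProb s n
  have hnR : (0 : ℝ) < n := by exact_mod_cast hn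
  have hcard : Fintype.card (Fin n) = n := Fintype.card_fin n
  have htrunc : (truncProb p : ℝ) = p := by
    rw [truncProb, Set.projIcc_of_mem _ ⟨hp.le, hp1⟩]
  have hπ0 := edgeProb_nonneg (V := Fin n) hp.le
  have hπ1 := edgeProb_le_one (V := Fin n) hp1
  have hb : 32 * (s + 2) ^ 2 * (ρ n * a n) ≤ n := by
    rw [div_lt_div_iff₀ hnR (by positivity)] at hsize
    have : (32 * (s + 2) ^ 2 * (ρ n * a n : ℕ) : ℝ) ≤ n := by linarith
    exact_mod_cast this
  have hgn : 32 * (s + 2) ^ 2 * g ≤ n := by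
    rw [one_div_mul_eq_div, le_div_iff₀ (by positivity)] at hg
    have : (32 * (s + 2) ^ 2 * g : ℝ) ≤ n := by linarith
    exact_mod_cast this
  have hdeg : ∀ v, g ≤ (nbrs G v).card := by
    intro v
    rw [← hG]
    refine (G.minDegree_le_degree v).trans (le_of_eq ?_)
    rw [← SimpleGraph.card_neighborFinset_eq_degree]
    congr 1
    ext w; simp [mem_nbrs]
  have hcl : pr (edgeProb (Fin n) p) (fun S => ¬ ∀ B : Finset (Fin n), ρ n * a n ≤ B.card →
      ∃ A ⊆ B, (SimpleGraph.fromEdgeSet (S : Set (Sym2 (Fin n)))).IsNClique s A) ≤ ε / 2 := by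
    refine (pr_not_forall_clique_le (by omega) hp hp1 ?_ (by rw [hcard]; exact hclique)).trans ?_
    · have hq : ((ρ n * a n / s : ℕ) : ℝ) ≤ n := by
        have h1 : ρ n * a n ≤ n := le_trans (Nat.le_mul_of_pos_left _ (by positivity)) hb
        exact_mod_cast (Nat.div_le_self _ _).trans h1
      rw [lt_div_iff₀ (by positivity)] at hpow
      calc _ ≤ (2 : ℝ) ^ (2 * s + 2) * ((n : ℝ) ^ 2 * p ^ (s + 1)) := by gcongr
        _ ≤ 1 := by linarith
    · rw [hcard]; exact hexpn.le
  rw [binomialRandom_real_eq_pr, htrunc]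
  have hmono : ∀ S : Finset (Sym2 (Fin n)), (∀ B : Finset (Fin n), ρ n * a n ≤ B.card →
      ∃ A ⊆ B, (SimpleGraph.fromEdgeSet (S : Set (Sym2 (Fin n)))).IsNClique s A) →
      ∀ B : Finset (Fin n), ρ n * a n ≤ B.card → ∃ A ⊆ B,
        (G ⊔ SimpleGraph.fromEdgeSet (S : Set (Sym2 (Fin n)))).IsNClique s A := by
    intro S hS B hB
    obtain ⟨A, hA, hAc⟩ := hS B hB
    exact ⟨A, hA, hAc.mono le_sup_right⟩
  suffices hfail : pr (edgeProb (Fin n) p) (fun S => ¬ HasDisjointCliques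
      (G ⊔ SimpleGraph.fromEdgeSet (S : Set (Sym2 (Fin n)))) (s + 1) g) ≤ ε by
    rw [pr_not] at hfail
    simp only [Set.mem_ofPred_eq]
    linarith
  -- The alternative, Z and g' depend on G alone and are fixed before the random edges are exposed.
  -- The two failure events share one random graph and are combined by a union bound, ε/2 each.
  rcases packing_reduction (s := s) (b := ρ n * a n) hdeg (by rw [hcard]; exact hgn)
    (by rw [hcard]; exact hb) (by rw [hcard]; exact hn) with hred | ⟨Z, g', hZ, hg1, hgb, hZd, hred⟩
  · refine (pr_mono hπ0 hπ1 fun S hS hall => ?_).trans (hcl.trans (by linarith))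
    obtain ⟨K, hK, hKc⟩ := hred _ le_sup_left (hmono S hall)
    exact hS (hasDisjointCliques_of_packing hK hKc)
  · have hrand := pr_not_packing_le (V := Fin n) hs hp hp1 hu
      (by rw [hcard]; exact Nat.mul_div_le n _) hρ (by rw [hcard]; exact hρn) hθ
      (by rw [hcard]; exact hθ1) (by rw [hcard]; exact hθ2) (by rw [hcard]; exact hδ) hδ1
      hZ hg1 hgb hZd
    refine (pr_mono hπ0 hπ1 fun S hS => ?_).trans
      ((pr_or_le hπ0 hπ1 _ _).trans ((add_le_add hcl (hrand.trans herr)).trans (by linarith)))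
    by_contra hcon
    push Not at hcon
    obtain ⟨hall, hpack⟩ := hcon
    obtain ⟨K, hK, hKc⟩ := hred _ le_sup_left (hmono S hall) hpack
    exact hS (hasDisjointCliques_of_packing hK hKc)
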